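/- **Setting.** Let $d\ge 2$, $K\ge 2$, $T\ge 3$ and let $\mathcal A=\{x^{(1)},\dots,x^{(K)}\}\subset\mathbb R^d$ with $\|x^{(k)}\|\le 1$. In round $t=1,\dots,T$ an arm $x_t\in\mathcal A$ is pulled and $r_t=\langle x_t,\theta^*\rangle+\eta_t$ is observed, where $\|\theta^*\|\le 1$ and $\eta_1,\dots,\eta_T$ are independent and $1$-subgaussian ($\mathbb E e^{s\eta_t}\le e^{s^2/2}$ for all $s\in\mathbb R$). Let $\mathcal R(T)=\mathbb E\sum_{t=1}^T\big(\max_{x\in\mathcal A}\langle x,\theta^*\rangle-\langle x_t,\theta^*\rangle\big)$. Write $N_\ell=T^{1-2^{-\ell}}$, $\|v\|_H=\sqrt{v^\top Hv}$, and $a\wedge b$ for the minimum. **Algorithm BLAE** (regularization $\lambda>0$, rates $c_\ell\in(0,1]$, thresholds $\varepsilon_\ell$). Put $\mathcal A_0=\mathcal A$, in any order, and $t_0=0$. Batch $\ell=1,2,\dots$, as long as $t_{\ell-1}<T$: with $V_\ell(\pi)=\frac{\lambda}{c_\ell}I+\sum_{i}\pi_iN_\ell\,x^{(i)}x^{(i)\top}$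 (sum over $\mathcal A_{\ell-1}$), let $\pi^*_\ell$ minimize $\max_{x\in\mathcal A_{\ell-1}}\|x\|^2_{V_\ell(\pi)^{-1}}$ over the probability vectors on $\mathcal A_{\ell-1}$. Go through $\mathcal A_{\ell-1}$ in its order and pull its $i$-th arm $\lceil N_\ell(c_\ell\pi^*_{\ell i}+(1-c_\ell)\mathbf 1\{i=1\})\rceil$ times, stopping when $T$ rounds are over. Let $t_\ell$ be the number of rounds so far, $H_\ell=\lambda I+\sum_{s=t_{\ell-1}+1}^{t_\ell}x_sx_s^\top$, $\hat\theta_\ell=H_\ell^{-1}\sum_{s=t_{\ell-1}+1}^{t_\ell}r_sx_s$, $\hat x^*_\ell\in\arg\max_{x\in\mathcal A_{\ell-1}}\langle x,\hat\theta_\ell\rangle$, and $\mathcal A_\ell=\{x\in\mathcal A_{\ell-1}:\langle\hat\theta_\ell,\hat x^*_\ell-x\rangle\le\varepsilon_\ell\}$, ordered so that $\hat x_\ell^*$ comes first. Rates, thresholds, orderings and tie-breaking may depend (measurably) on the rewards of the earlier batches, for $\varepsilon_\ell$ and the order of $\mathcal A_\ell$ including batch $\ell$. **Thresholds.** Let $b=1+\lceil\log_2\log_2T\rceil$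 and $$w_\ell=\max_{x,y\in\mathcal A_{\ell-1}}\|x-y\|_{H_\ell^{-1}}\cdot\Big[\Big(2\sqrt{\log\tfrac{8\pi d\,b^2T^2}{(15/64)^{d-1}}}+2\sqrt\lambda\Big)\wedge\Big(\sqrt{2\log\big((|\mathcal A_{\ell-1}|^2-|\mathcal A_{\ell-1}|)\,bT\big)}+\sqrt\lambda\Big)\Big]$$ (so $w_\ell=0$ if $|\mathcal A_{\ell-1}|=1$), and $$\rho_\ell=\sqrt{dT^{-(1-2^{-\ell})}}\,\big(\sqrt{\log(KT)}\wedge\sqrt{d+\log T}\big).$$ **Theorem (regret of BLAE).** For all constants $a,c_{\min},\lambda_{\max}>0$ and $M\ge0$ there is a constant $C>0$, depending only on them, such that the following holds whenever $$T\ \ge\ a\max\Big\{\frac{K^2}{(d\wedge\log K)\,d},\,K^{4/5}\Big\},\qquad 0<\lambda\le\lambda_{\max},\qquad c_{\min}\le c_\ell\le1,$$ and $w_\ell\le\varepsilon_\ell\le\max\{w_\ell,M\rho_\ell\}$ for every batch $\ell$ with $t_\ell<T$ (for instance $\varepsilon_\ell=w_\ell$). 1. $w_\ell\le C\rho_\ell$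 for every batch $\ell$ with $t_\ell<T$; hence $\varepsilon_\ell=O(\rho_\ell)$. 2. BLAE completes the $T$ rounds in at most $C\log\log T$ batches. Batch $\ell$ has at most $N_\ell+|\mathcal A_{\ell-1}|$ rounds and, if $t_\ell<T$, at least $N_\ell$ rounds. 3. The expected regret satisfies $$\mathcal R(T)\le C\sqrt{dT}\,\big(\sqrt{\log(KT)}\wedge\sqrt{d+\log T}\big)\log\log T$$ and $$\mathcal R(T)\le C\,\big(\sqrt{dT\log K}\wedge d\sqrt T\big)\log T,$$ so that $\mathcal R(T)=\widetilde O(\sqrt{dT\log K}\wedge d\sqrt T)$. -/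

import Mathlib

open MeasureTheory ProbabilityTheory
open scoped Matrix NNReal

noncomputable section

namespace BLAE

/-- The target length `T ^ (1 - 2 ^ (-ℓ))` of the `ℓ`-th batch, `ℓ ≥ 1`. -/
def targetLen (T ℓ : ℕ) : ℝ := (T : ℝ) ^ (((2 : ℝ) ^ ℓ - 1) / (2 : ℝ) ^ ℓ)

/-- The rank-one matrix `v vᵀ`. -/
def outer {d : ℕ} (v : EuclideanSpace ℝ (Fin d)) : Matrix (Fin d) (Fin d) ℝ :=
  Matrix.vecMulVec v.ofLp v.ofLp

/-- The weighted norm `‖v‖_H = √(vᵀ H v)`. -/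
def wnorm {d : ℕ} (H : Matrix (Fin d) (Fin d) ℝ) (v : EuclideanSpace ℝ (Fin d)) : ℝ :=
  √(v.ofLp ⬝ᵥ (H *ᵥ v.ofLp))

/-- The regularized design matrix
`V_ℓ(π) = (lam / c) I + ∑_{i ∈ A} π_i T^{1 - 2^{-ℓ}} x_i x_iᵀ`. -/
def designMatrix {d K : ℕ} (x : Fin K → EuclideanSpace ℝ (Fin d)) (T : ℕ) (lam c : ℝ) (ℓ : ℕ)
    (A : Finset (Fin K)) (w : Fin K → ℝ) : Matrix (Fin d) (Fin d) ℝ :=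
  (lam / c) • (1 : Matrix (Fin d) (Fin d) ℝ) + ∑ i ∈ A, (w i * targetLen T ℓ) • outer (x i)

/-- `max_{i ∈ A} ‖x_i‖²_{V_ℓ(π)⁻¹}`. -/
def designValue {d K : ℕ} (x : Fin K → EuclideanSpace ℝ (Fin d)) (T : ℕ) (lam c : ℝ) (ℓ : ℕ)
    (A : Finset (Fin K)) (w : Fin K → ℝ) : ℝ :=
  ⨆ i : A, wnorm (designMatrix x T lam c ℓ A w)⁻¹ (x i) ^ 2

/-- Probability weights on the arms in `A`. -/
def IsWeight {K : ℕ} (A : Finset (Fin K)) (w : Fin K → ℝ) : Prop :=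
  (∀ i ∈ A, 0 ≤ w i) ∧ ∑ i ∈ A, w i = 1

/-- `w` solves the regularized G-optimal design problem of the `ℓ`-th batch. -/
def IsOptimalDesign {d K : ℕ} (x : Fin K → EuclideanSpace ℝ (Fin d)) (T : ℕ) (lam c : ℝ) (ℓ : ℕ)
    (A : Finset (Fin K)) (w : Fin K → ℝ) : Prop :=
  IsWeight A w ∧
    ∀ w' : Fin K → ℝ, IsWeight A w' → designValue x T lam c ℓ A w ≤ designValue x T lam c ℓ A w'

/-- `H = lam I + ∑_s x_{b_s} x_{b_s}ᵀ`, the sum running over the rounds of a batch in which the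
arms `b` were pulled. -/
def gram {d K : ℕ} (x : Fin K → EuclideanSpace ℝ (Fin d)) (lam : ℝ) (b : List (Fin K)) :
    Matrix (Fin d) (Fin d) ℝ :=
  lam • (1 : Matrix (Fin d) (Fin d) ℝ) + (b.map fun i => outer (x i)).sum

/-- The regularized least squares estimator `H⁻¹ ∑_s r_s x_{b_s}` from one batch: the arms `b`
were pulled in the rounds `t, t + 1, …` and `r` is the sequence of rewards. -/
def estimator {d K : ℕ} (x : Fin K → EuclideanSpace ℝ (Fin d)) (lam : ℝ) (b : List (Fin K))
    (t : ℕ) (r : ℕ → ℝ) : EuclideanSpace ℝ (Fin d) :=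
  WithLp.toLp 2
    ((gram x lam b)⁻¹ *ᵥ (∑ s : Fin b.length, r (t + s) • x (b.get s)).ofLp)

/-- `1 + ⌈log₂ log₂ T⌉`. -/
def batchBound (T : ℕ) : ℕ := 1 + ⌈Real.logb 2 (Real.logb 2 T)⌉₊

/-- The confidence radius (at level `δ`) that is useful when there are many arms. -/
def radiusLarge (d T : ℕ) (lam δ : ℝ) : ℝ :=
  2 * √(Real.log (8 * Real.pi * d * (batchBound T : ℝ) ^ 2 /
    ((15 / 64 : ℝ) ^ (d - 1) * δ ^ 2))) + 2 * √lam

/-- The confidence radius (at level `δ`) that is useful when there are few arms, where `n` is the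
number of remaining arms. -/
def radiusSmall (n T : ℕ) (lam δ : ℝ) : ℝ :=
  √(2 * Real.log (((n : ℝ) ^ 2 - n) / (δ / (batchBound T : ℝ)))) + √lam

/-- The elimination threshold of the algorithm,
`max_{i, j ∈ A} ‖x_i - x_j‖_{H⁻¹} · min (radiusLarge, radiusSmall)` at level `δ = 1 / T`, where `A`
are the arms available in the batch and `b` is the list of the arms pulled in it. -/
def confWidth {d K : ℕ} (x : Fin K → EuclideanSpace ℝ (Fin d)) (T : ℕ) (lam : ℝ)
    (A : Finset (Fin K)) (b : List (Fin K)) : ℝ :=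
  (⨆ p : A × A, wnorm (gram x lam b)⁻¹ (x p.1 - x p.2)) *
    min (radiusLarge d T lam (1 / T)) (radiusSmall A.card T lam (1 / T))

/-- `√(log (K T)) ∧ √(d + log T)`. -/
def logFactor (d K T : ℕ) : ℝ :=
  min (√(Real.log ((K : ℝ) * T))) (√((d : ℝ) + Real.log T))

/-- `√(d T^{-(1 - 2^{-ℓ})}) (√(log (K T)) ∧ √(d + log T))`, the order of the `ℓ`-th threshold. -/
def thresholdOrder (d K T ℓ : ℕ) : ℝ :=
  √((d : ℝ) * (T : ℝ) ^ (-(((2 : ℝ) ^ ℓ - 1) / (2 : ℝ) ^ ℓ))) * logFactor d K T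

/-- Everything that a run of the algorithm decides between two batches. All entries are functions
of the number `ℓ` of completed batches, of the number `t` of completed rounds and of the rewards
`h 0, …, h (t - 1)` of those rounds. -/
structure Policy (K : ℕ) where
  /-- The remaining arms `A_ℓ` in the order used in the next batch. -/
  order : (ℓ t : ℕ) → (Fin t → ℝ) → List (Fin K)
  /-- The exploration-exploitation rate `c_{ℓ+1}` of the next batch. -/
  rate : (ℓ t : ℕ) → (Fin t → ℝ) → ℝ
  /-- The sampling weights `π*_{ℓ+1}` of the next batch. -/
  weight : (ℓ t : ℕ) → (Fin t → ℝ) → Fin K → ℝ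
  /-- The elimination threshold `ε_ℓ` of the batch that has just ended. -/
  threshold : (ℓ t : ℕ) → (Fin t → ℝ) → ℝ

namespace Policy

variable {K : ℕ}

/-- The intended number of pulls of arm `i` in batch `ℓ + 1`. -/
def pullCount (P : Policy K) (T ℓ t : ℕ) (h : Fin t → ℝ) (i : Fin K) : ℕ :=
  ⌈targetLen T (ℓ + 1) * (P.rate ℓ t h * P.weight ℓ t h i +
    (1 - P.rate ℓ t h) * (if (P.order ℓ t h).head? = some i then 1 else 0))⌉₊

/-- The arms pulled in batch `ℓ + 1`, in order: the remaining arms are gone through in their order,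
each being pulled its intended number of times, and the batch is cut off when the horizon `T` is
reached. -/
def batch (P : Policy K) (T ℓ t : ℕ) (h : Fin t → ℝ) : List (Fin K) :=
  ((P.order ℓ t h).flatMap fun i => List.replicate (P.pullCount T ℓ t h i) i).take (T - t)

/-- The arms pulled in the first `ℓ` batches when `r 0, r 1, …` are the rewards. -/
def played (P : Policy K) (T : ℕ) (r : ℕ → ℝ) : ℕ → List (Fin K)
  | 0 => []
  | ℓ + 1 => P.played T r ℓ ++ P.batch T ℓ (P.played T r ℓ).length (fun s => r s)

/-- The number `t_ℓ` of rounds in the first `ℓ` batches. -/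
def elapsed (P : Policy K) (T : ℕ) (r : ℕ → ℝ) (ℓ : ℕ) : ℕ := (P.played T r ℓ).length

/-- The remaining arms `A_ℓ` after `ℓ` batches. -/
def arms (P : Policy K) (T : ℕ) (r : ℕ → ℝ) (ℓ : ℕ) : List (Fin K) :=
  P.order ℓ (P.elapsed T r ℓ) (fun s => r s)

/-- The arms pulled in batch `ℓ + 1`. -/
def pulls (P : Policy K) (T : ℕ) (r : ℕ → ℝ) (ℓ : ℕ) : List (Fin K) :=
  P.batch T ℓ (P.elapsed T r ℓ) (fun s => r s)

/-- The rate `c_{ℓ+1}` used in batch `ℓ + 1`. -/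
def rateAt (P : Policy K) (T : ℕ) (r : ℕ → ℝ) (ℓ : ℕ) : ℝ :=
  P.rate ℓ (P.elapsed T r ℓ) (fun s => r s)

/-- The weights `π*_{ℓ+1}` used in batch `ℓ + 1`. -/
def weightAt (P : Policy K) (T : ℕ) (r : ℕ → ℝ) (ℓ : ℕ) : Fin K → ℝ :=
  P.weight ℓ (P.elapsed T r ℓ) (fun s => r s)

/-- The threshold `ε_ℓ` used at the end of batch `ℓ`. -/
def thresholdAt (P : Policy K) (T : ℕ) (r : ℕ → ℝ) (ℓ : ℕ) : ℝ :=
  P.threshold ℓ (P.elapsed T r ℓ) (fun s => r s)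

/-- The arms pulled over the whole horizon. As long as fewer than `T` rounds are over, every batch
of the algorithm has at least one round, so that `T` batches suffice. -/
def allPlayed (P : Policy K) (T : ℕ) (r : ℕ → ℝ) : List (Fin K) := P.played T r T

end Policy

/-- `P` is a run of the algorithm BLAE on the arms `x` with horizon `T` and regularization `lam`,
with rates and thresholds as recorded in `P`; ties (between optimal designs, between empirically
best arms, between orderings) are broken in an arbitrary way that depends measurably on the past. -/
structure IsBLAE {d K : ℕ} (x : Fin K → EuclideanSpace ℝ (Fin d)) (T : ℕ) (lam : ℝ)
    (P : Policy K) : Prop where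
  measurable_order : ∀ ℓ t L, MeasurableSet {h : Fin t → ℝ | P.order ℓ t h = L}
  measurable_rate : ∀ ℓ t, Measurable (P.rate ℓ t)
  measurable_weight : ∀ ℓ t, Measurable (P.weight ℓ t)
  /-- All rates lie in `(0, 1]`. -/
  rate_mem : ∀ ℓ t h, P.rate ℓ t h ∈ Set.Ioc (0 : ℝ) 1
  /-- The algorithm starts with all arms, in an arbitrary order. -/
  init : ∀ r : ℕ → ℝ, (P.arms T r 0).Nodup ∧ ∀ i, i ∈ P.arms T r 0
  /-- The weights of each batch solve the regularized G-optimal design problem. -/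
  design : ∀ (r : ℕ → ℝ) (ℓ : ℕ), P.elapsed T r ℓ < T →
    IsOptimalDesign x T lam (P.rateAt T r ℓ) (ℓ + 1) (P.arms T r ℓ).toFinset (P.weightAt T r ℓ)
  /-- After each batch an empirically best arm `i₀` is determined, the arms that are worse than it
  by more than the threshold are eliminated, and `i₀` is put first. -/
  update : ∀ (r : ℕ → ℝ) (ℓ : ℕ), P.elapsed T r ℓ < T →
    ∃ i₀ ∈ P.arms T r ℓ,
      (∀ j ∈ P.arms T r ℓ,
        inner ℝ (estimator x lam (P.pulls T r ℓ) (P.elapsed T r ℓ) r) (x j) ≤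
          inner ℝ (estimator x lam (P.pulls T r ℓ) (P.elapsed T r ℓ) r) (x i₀)) ∧
      (P.arms T r (ℓ + 1)).head? = some i₀ ∧
      (P.arms T r (ℓ + 1)).Nodup ∧
      ∀ i, i ∈ P.arms T r (ℓ + 1) ↔ i ∈ P.arms T r ℓ ∧
        inner ℝ (estimator x lam (P.pulls T r ℓ) (P.elapsed T r ℓ) r) (x i₀ - x i) ≤
          P.thresholdAt T r (ℓ + 1)

/-- The sum of `⟨x*, θ⟩ - ⟨x_i, θ⟩` over a list of pulled arms, `x*` being a best arm. -/
def regret {d K : ℕ} (x : Fin K → EuclideanSpace ℝ (Fin d)) (θ : EuclideanSpace ℝ (Fin d))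
    (b : List (Fin K)) : ℝ :=
  (b.map fun i => (⨆ j, inner ℝ (x j) θ) - inner ℝ (x i) θ).sum

end BLAE

end

namespace BLAE

/-! ### Quadratic forms, weighted norms and the Gram matrix -/

variable {d : ℕ}

/-! A batch of length about N_ℓ that follows a G-optimal design estimates all differences of
remaining arms up to √(d/N_ℓ) times a logarithmic factor. By the Kiefer-Wolfowitz argument
(`exists_isWeight_quad_le`) a maximizer of det V_ℓ(π) satisfies ‖x‖² ≤ d/N_ℓ in the norm of V_ℓ(π)⁻¹
for every remaining arm, so the optimal design does at least as well. Rounding the counts up gives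
H_ℓ ≥ c_ℓ V_ℓ for a complete batch, and hence w_ℓ ≤ C ρ_ℓ (`IsBLAE.confWidth_le`).

The confidence radius is the smaller of two. One comes from Chernoff's bound in a fixed direction
and a union bound over pairs of arms; the other from an exponential moment of Sᵀ H⁻¹ S, where S is
the noise sum of the batch, which controls all directions at once. Given the history, the arms of a
batch are fixed and its noise is independent of that history. So each batch fails with probability
at most 1/(bT), and some batch fails with probability at most 1/T
(`IsBLAE.measure_exists_isBadBatch_le`).

If no batch fails, a best arm is never eliminated and every arm that survives batch ℓ has gap at
most ε_ℓ + w_ℓ = O(ρ_ℓ). The exponents 1 - 2^{-ℓ} are chosen so that N_{ℓ+1} ρ_ℓ is √(dT) times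
`logFactor`, whatever ℓ is: all batches obey the same bound, up to 2K for the rounding, which the
lower bound on T absorbs. As N_ℓ ≥ T/2 once 2^ℓ ≥ log₂ T, the horizon is reached within b = O(log
log T) batches. Summation gives the first regret bound, failure adding at most 2T · (1/T). The
second bound follows from the first, because √(log T) · log log T ≤ 2 log T. -/

theorem PosSemidef.quad_nonneg {H : Matrix (Fin d) (Fin d) ℝ} (hH : H.PosSemidef)
    (v : Fin d → ℝ) : 0 ≤ v ⬝ᵥ (H *ᵥ v) := by
  simpa using hH.dotProduct_mulVec_nonneg v

theorem IsHermitian.bilin_comm {H : Matrix (Fin d) (Fin d) ℝ} (hH : H.IsHermitian)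
    (u v : Fin d → ℝ) : u ⬝ᵥ (H *ᵥ v) = v ⬝ᵥ (H *ᵥ u) := by
  have h : Hᵀ = H := by simpa [Matrix.IsHermitian] using hH
  rw [Matrix.dotProduct_mulVec, ← Matrix.mulVec_transpose, h, dotProduct_comm]

theorem IsHermitian.quad_add_smul {H : Matrix (Fin d) (Fin d) ℝ} (hH : H.IsHermitian)
    (u v : Fin d → ℝ) (s : ℝ) :
    (u + s • v) ⬝ᵥ (H *ᵥ (u + s • v)) =
      u ⬝ᵥ (H *ᵥ u) + 2 * s * (u ⬝ᵥ (H *ᵥ v)) + s ^ 2 * (v ⬝ᵥ (H *ᵥ v)) := by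
  simp only [Matrix.mulVec_add, Matrix.mulVec_smul, dotProduct_add, add_dotProduct,
    smul_dotProduct, dotProduct_smul, smul_eq_mul]
  rw [IsHermitian.bilin_comm hH v u]
  ring

theorem PosDef.mulVec_inv_mulVec {H : Matrix (Fin d) (Fin d) ℝ} (hH : H.PosDef)
    (v : Fin d → ℝ) : H *ᵥ (H⁻¹ *ᵥ v) = v := by
  rw [Matrix.mulVec_mulVec, Matrix.mul_nonsing_inv _ ((Matrix.isUnit_iff_isUnit_det _).1 hH.isUnit),
    Matrix.one_mulVec]

theorem PosDef.inv_mulVec_mulVec {H : Matrix (Fin d) (Fin d) ℝ} (hH : H.PosDef)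
    (v : Fin d → ℝ) : H⁻¹ *ᵥ (H *ᵥ v) = v := by
  rw [Matrix.mulVec_mulVec, Matrix.nonsing_inv_mul _ ((Matrix.isUnit_iff_isUnit_det _).1 hH.isUnit),
    Matrix.one_mulVec]

/-- Cauchy-Schwarz for a quadratic form. -/
theorem PosSemidef.bilin_sq_le {H : Matrix (Fin d) (Fin d) ℝ} (hH : H.PosSemidef)
    (u v : Fin d → ℝ) : (u ⬝ᵥ (H *ᵥ v)) ^ 2 ≤ (u ⬝ᵥ (H *ᵥ u)) * (v ⬝ᵥ (H *ᵥ v)) := by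
  have h : ∀ s : ℝ, 0 ≤ (v ⬝ᵥ (H *ᵥ v)) * (s * s) + (2 * (u ⬝ᵥ (H *ᵥ v))) * s
      + u ⬝ᵥ (H *ᵥ u) := by
    intro s
    have := PosSemidef.quad_nonneg hH (u + s • v)
    rw [IsHermitian.quad_add_smul hH.isHermitian] at this
    linarith
  have := discrim_le_zero h
  rw [discrim] at this
  linarith

/-- Cauchy-Schwarz for the form `H` applied to `u` and `H⁻¹ v`. -/
theorem PosDef.dotProduct_sq_le {H : Matrix (Fin d) (Fin d) ℝ} (hH : H.PosDef)
    (u v : Fin d → ℝ) : (u ⬝ᵥ v) ^ 2 ≤ (u ⬝ᵥ (H *ᵥ u)) * (v ⬝ᵥ (H⁻¹ *ᵥ v)) := by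
  have := PosSemidef.bilin_sq_le hH.posSemidef u (H⁻¹ *ᵥ v)
  rw [PosDef.mulVec_inv_mulVec hH] at this
  rwa [dotProduct_comm v]

/-- The quadratic form of the inverse is antitone. -/
theorem PosDef.quad_inv_le {H V : Matrix (Fin d) (Fin d) ℝ} (hH : H.PosDef) (hV : V.PosDef)
    {c : ℝ} (hc : 0 < c) (hHV : ∀ v : Fin d → ℝ, c * (v ⬝ᵥ (V *ᵥ v)) ≤ v ⬝ᵥ (H *ᵥ v))
    (v : Fin d → ℝ) : v ⬝ᵥ (H⁻¹ *ᵥ v) ≤ c⁻¹ * (v ⬝ᵥ (V⁻¹ *ᵥ v)) := by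
  -- With u = H⁻¹v, q = vᵀH⁻¹v and p = vᵀV⁻¹v: Cauchy-Schwarz gives q² ≤ (uᵀVu) p, and c uᵀVu ≤ uᵀHu
  -- = q. Hence c q² ≤ q p, and q cancels unless it is 0.
  have h1 := PosDef.dotProduct_sq_le hV (H⁻¹ *ᵥ v) v
  have h2 := hHV (H⁻¹ *ᵥ v)
  rw [PosDef.mulVec_inv_mulVec hH] at h2
  rw [dotProduct_comm (H⁻¹ *ᵥ v) v] at h1 h2
  have h3 := PosSemidef.quad_nonneg hV.inv.posSemidef v
  have h4 := PosSemidef.quad_nonneg hH.inv.posSemidef v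
  set q := v ⬝ᵥ (H⁻¹ *ᵥ v)
  set p := v ⬝ᵥ (V⁻¹ *ᵥ v)
  rcases h4.eq_or_lt with h | h
  · rw [← h]; positivity
  · rw [inv_mul_eq_div, le_div_iff₀ hc]
    have : q * (q * c) ≤ q * p := by nlinarith
    exact le_of_mul_le_mul_left this h

theorem wnorm_nonneg (H : Matrix (Fin d) (Fin d) ℝ) (v : EuclideanSpace ℝ (Fin d)) :
    0 ≤ wnorm H v := Real.sqrt_nonneg _

theorem wnorm_sq {H : Matrix (Fin d) (Fin d) ℝ} (hH : H.PosSemidef)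
    (v : EuclideanSpace ℝ (Fin d)) : wnorm H v ^ 2 = v.ofLp ⬝ᵥ (H *ᵥ v.ofLp) :=
  Real.sq_sqrt (PosSemidef.quad_nonneg hH _)

/-- The parallelogram law without the term of `v + w`. -/
theorem wnorm_sub_sq_le {H : Matrix (Fin d) (Fin d) ℝ} (hH : H.PosSemidef)
    (v w : EuclideanSpace ℝ (Fin d)) :
    wnorm H (v - w) ^ 2 ≤ 2 * wnorm H v ^ 2 + 2 * wnorm H w ^ 2 := by
  simp only [wnorm_sq hH]
  have h1 := IsHermitian.quad_add_smul hH.isHermitian v.ofLp w.ofLp 1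
  have h2 := IsHermitian.quad_add_smul hH.isHermitian v.ofLp w.ofLp (-1)
  have h3 := PosSemidef.quad_nonneg hH (v.ofLp + (1 : ℝ) • w.ofLp)
  have h4 : (v - w).ofLp = v.ofLp + (-1 : ℝ) • w.ofLp := by ext i; simp [sub_eq_add_neg]
  rw [h4]
  linarith

theorem quad_outer (v : EuclideanSpace ℝ (Fin d)) (u : Fin d → ℝ) :
    u ⬝ᵥ (outer v *ᵥ u) = (u ⬝ᵥ v.ofLp) ^ 2 := by
  rw [outer, Matrix.vecMulVec_mulVec]
  simp [dotProduct_comm v.ofLp u, sq]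

theorem outer_posSemidef (v : EuclideanSpace ℝ (Fin d)) : (outer v).PosSemidef := by
  simpa [outer] using Matrix.posSemidef_vecMulVec_self_star v.ofLp

theorem smul_one_posDef {c : ℝ} (hc : 0 < c) : (c • (1 : Matrix (Fin d) (Fin d) ℝ)).PosDef :=
  Matrix.PosDef.one.smul hc

theorem norm_sq_eq_dotProduct (v : EuclideanSpace ℝ (Fin d)) :
    ‖v‖ ^ 2 = v.ofLp ⬝ᵥ v.ofLp := by
  rw [EuclideanSpace.real_norm_sq_eq]
  simp [dotProduct, sq]

theorem inner_eq_dotProduct (v w : EuclideanSpace ℝ (Fin d)) :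
    inner ℝ v w = v.ofLp ⬝ᵥ w.ofLp := by
  rw [EuclideanSpace.inner_eq_star_dotProduct, dotProduct_comm]
  simp

variable {K : ℕ}

theorem gram_quad (x : Fin K → EuclideanSpace ℝ (Fin d)) (lam : ℝ) (b : List (Fin K))
    (u : Fin d → ℝ) :
    u ⬝ᵥ (gram x lam b *ᵥ u) = lam * (u ⬝ᵥ u) + (b.map fun i => (u ⬝ᵥ (x i).ofLp) ^ 2).sum := by
  rw [gram, Matrix.add_mulVec, dotProduct_add]
  congr 1
  · simp [Matrix.smul_mulVec]
  · induction b with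
    | nil => simp
    | cons i b ih =>
      simp only [List.map_cons, List.sum_cons, Matrix.add_mulVec, dotProduct_add, quad_outer, ih]

theorem gram_posDef (x : Fin K → EuclideanSpace ℝ (Fin d)) {lam : ℝ} (hlam : 0 < lam)
    (b : List (Fin K)) : (gram x lam b).PosDef := by
  refine (smul_one_posDef hlam).add_posSemidef ?_
  induction b with
  | nil => simpa using Matrix.PosSemidef.zero
  | cons i b ih => simpa using (outer_posSemidef (x i)).add ih

/-- The bias term of the regularized least squares estimator. -/
theorem bias_le (x : Fin K → EuclideanSpace ℝ (Fin d)) {lam : ℝ} (hlam : 0 < lam)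
    (b : List (Fin K)) (v θ : EuclideanSpace ℝ (Fin d)) (hθ : ‖θ‖ ≤ 1) :
    |lam * (v.ofLp ⬝ᵥ ((gram x lam b)⁻¹ *ᵥ θ.ofLp))| ≤ √lam * wnorm (gram x lam b)⁻¹ v := by
  have hH := gram_posDef x hlam b
  have h1 := PosSemidef.bilin_sq_le hH.inv.posSemidef v.ofLp θ.ofLp
  -- Since H ≥ λI, the form of H⁻¹ at θ is at most 1/λ; this turns the factor λ into √λ.
  have h2 := PosDef.quad_inv_le hH Matrix.PosDef.one hlam (fun u => by
    rw [gram_quad, Matrix.one_mulVec]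
    refine le_add_of_nonneg_right (List.sum_nonneg ?_)
    simp only [List.mem_map, forall_exists_index, and_imp]
    rintro _ i _ rfl
    positivity) θ.ofLp
  rw [inv_one, Matrix.one_mulVec, ← norm_sq_eq_dotProduct] at h2
  rw [← wnorm_sq hH.inv.posSemidef v] at h1
  have h3 : ‖θ‖ ^ 2 ≤ 1 := by nlinarith [norm_nonneg θ]
  have h4 : θ.ofLp ⬝ᵥ ((gram x lam b)⁻¹ *ᵥ θ.ofLp) ≤ lam⁻¹ :=
    h2.trans (mul_le_of_le_one_right (by positivity) h3)
  refine abs_le_of_sq_le_sq ?_ (mul_nonneg (Real.sqrt_nonneg _) (wnorm_nonneg _ _))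
  rw [mul_pow, mul_pow, Real.sq_sqrt hlam.le]
  calc lam ^ 2 * (v.ofLp ⬝ᵥ ((gram x lam b)⁻¹ *ᵥ θ.ofLp)) ^ 2
      ≤ lam ^ 2 * (wnorm (gram x lam b)⁻¹ v ^ 2 * lam⁻¹) := by gcongr; exact h1.trans (by gcongr)
    _ = lam * wnorm (gram x lam b)⁻¹ v ^ 2 := by field_simp

/-! ### The regularized Kiefer-Wolfowitz bound -/

variable {d K : ℕ}

theorem targetLen_pos {T : ℕ} (hT : 0 < T) (ℓ : ℕ) : 0 < targetLen T ℓ :=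
  Real.rpow_pos_of_pos (by exact_mod_cast hT) _

theorem designMatrix_posDef (x : Fin K → EuclideanSpace ℝ (Fin d)) {T : ℕ} (hT : 0 < T)
    {lam c : ℝ} (hlam : 0 < lam) (hc : 0 < c) (ℓ : ℕ) {A : Finset (Fin K)} {w : Fin K → ℝ}
    (hw : ∀ i ∈ A, 0 ≤ w i) : (designMatrix x T lam c ℓ A w).PosDef :=
  (smul_one_posDef (div_pos hlam hc)).add_posSemidef <| Matrix.posSemidef_sum _ fun i hi =>
    (outer_posSemidef _).smul (mul_nonneg (hw i hi) (targetLen_pos hT ℓ).le)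

theorem trace_mul_outer (M : Matrix (Fin d) (Fin d) ℝ) (v : EuclideanSpace ℝ (Fin d)) :
    (M * outer v).trace = v.ofLp ⬝ᵥ (M *ᵥ v.ofLp) := by
  rw [outer, Matrix.mul_vecMulVec, Matrix.trace_vecMulVec, dotProduct_comm]

/-- If `det` does not increase from `V` in the direction of `W`, then `tr (V⁻¹ W) ≤ d`. -/
theorem trace_inv_mul_le {V W : Matrix (Fin d) (Fin d) ℝ} (hV : V.PosDef)
    (h : ∀ s : ℝ, 0 < s → s < 1 → (V + s • (W - V)).det ≤ V.det) :
    (V⁻¹ * W).trace ≤ d := by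
  have hu : IsUnit V.det := (Matrix.isUnit_iff_isUnit_det _).1 hV.isUnit
  set M := V⁻¹ * (W - V) with hM
  have h1 : ∀ s : ℝ, (V + s • (W - V)).det = V.det * (1 + s • M).det := by
    intro s
    rw [← Matrix.det_mul, mul_add, mul_one, mul_smul_comm, hM, ← mul_assoc,
      Matrix.mul_nonsing_inv _ hu, one_mul]
  -- Expand det(1 + sM) = 1 + s tr M + s² p(s), divide by s, and let s tend to 0 from the right.
  have h2 : ∀ s : ℝ, 0 < s → s < 1 → M.trace +
      ((Matrix.det (1 + (Polynomial.X : Polynomial ℝ) • M.map Polynomial.C)).divX.divX.eval s) * s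
        ≤ 0 := by
    intro s hs hs1
    have h3 := h s hs hs1
    rw [h1 s, Matrix.det_one_add_smul] at h3
    have h4 := le_of_mul_le_mul_left (h3.trans_eq (mul_one _).symm) hV.det_pos
    have h5 : s * (M.trace + ((Matrix.det (1 + (Polynomial.X : Polynomial ℝ) •
      M.map Polynomial.C)).divX.divX.eval s) * s) ≤ s * 0 := by linarith
    exact le_of_mul_le_mul_left h5 hs
  set p := (Matrix.det (1 + (Polynomial.X : Polynomial ℝ) • M.map Polynomial.C)).divX.divX
  have h6 : Filter.Tendsto (fun s : ℝ => M.trace + p.eval s * s) (nhdsWithin 0 (Set.Ioi 0))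
      (nhds (M.trace + p.eval 0 * 0)) := by
    have : Continuous fun s : ℝ => M.trace + p.eval s * s := by fun_prop
    exact (this.tendsto 0).mono_left nhdsWithin_le_nhds
  have h7 : M.trace + p.eval 0 * 0 ≤ 0 := by
    refine le_of_tendsto h6 ?_
    filter_upwards [Ioo_mem_nhdsGT (zero_lt_one' ℝ)] with s hs using h2 s hs.1 hs.2
  rw [mul_zero, add_zero, hM, mul_sub, Matrix.nonsing_inv_mul _ hu, Matrix.trace_sub,
    Matrix.trace_one, Fintype.card_fin] at h7
  linarith

theorem continuous_designMatrix (x : Fin K → EuclideanSpace ℝ (Fin d)) (T : ℕ) (lam c : ℝ) (ℓ : ℕ)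
    (A : Finset (Fin K)) : Continuous (designMatrix x T lam c ℓ A) := by
  unfold designMatrix
  fun_prop

/-- The Kiefer-Wolfowitz bound for the regularized G-optimal design. -/
theorem exists_isWeight_quad_le (x : Fin K → EuclideanSpace ℝ (Fin d)) {T : ℕ} (hT : 0 < T)
    {lam c : ℝ} (hlam : 0 < lam) (hc : 0 < c) (ℓ : ℕ) {A : Finset (Fin K)} (hA : A.Nonempty) :
    ∃ w, IsWeight A w ∧ ∀ j ∈ A,
      wnorm (designMatrix x T lam c ℓ A w)⁻¹ (x j) ^ 2 ≤ d / targetLen T ℓ := by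
  classical
  set N := targetLen T ℓ with hN
  have hN0 : 0 < N := targetLen_pos hT ℓ
  -- Weights are functions on all of `Fin K`; forcing them to vanish off `A` makes the feasible set
  -- compact.
  let S : Set (Fin K → ℝ) := stdSimplex ℝ (Fin K) ∩ {w | ∀ i, i ∉ A → w i = 0}
  have hS : IsCompact S := by
    refine (isCompact_stdSimplex ℝ (Fin K)).inter_right ?_
    simp only [Set.ofPred_forall]
    exact isClosed_iInter fun i => isClosed_iInter fun _ =>
      isClosed_eq (continuous_apply i) continuous_const
  have hsingle : ∀ j ∈ A, Pi.single j (1 : ℝ) ∈ S := fun j hj =>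
    ⟨single_mem_stdSimplex ℝ j, fun i hi => by
      rw [Pi.single_eq_of_ne]; rintro rfl; exact hi hj⟩
  have hSW : ∀ w ∈ S, IsWeight A w := fun w hw => ⟨fun i _ => hw.1.1 i, by
    rw [← hw.1.2]
    exact Finset.sum_subset (Finset.subset_univ _) fun i _ hi => hw.2 i hi⟩
  obtain ⟨j₀, hj₀⟩ := hA
  -- The witness maximizes the determinant (D-optimality), where first-order conditions are
  -- available.
  obtain ⟨w, hwS, hw⟩ := hS.exists_isMaxOn ⟨_, hsingle j₀ hj₀⟩
    (continuous_designMatrix x T lam c ℓ A).matrix_det.continuousOn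
  refine ⟨w, hSW w hwS, fun j hj => ?_⟩
  set V := designMatrix x T lam c ℓ A w with hVdef
  have hV : V.PosDef := designMatrix_posDef x hT hlam hc ℓ (hSW w hwS).1
  -- `W` is the design matrix of the point mass at `j`, so moving from `w` towards that mass is the
  -- segment V + s(W - V).
  set W := (lam / c) • (1 : Matrix (Fin d) (Fin d) ℝ) + N • outer (x j) with hW
  have htr : (V⁻¹ * W).trace ≤ d := by
    refine trace_inv_mul_le hV fun s hs hs1 => ?_
    have hmem : (1 - s) • w + s • Pi.single j (1 : ℝ) ∈ S := by
      refine ⟨convex_stdSimplex ℝ (Fin K) hwS.1 (hsingle j hj).1 (by linarith) hs.le (by ring),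
        fun i hi => ?_⟩
      simp [hwS.2 i hi, (hsingle j hj).2 i hi]
    have heq : V + s • (W - V) =
        designMatrix x T lam c ℓ A ((1 - s) • w + s • Pi.single j (1 : ℝ)) := by
      have h1 : ∑ i ∈ A, ((Pi.single j (1 : ℝ) : Fin K → ℝ) i * N) • outer (x i) =
          N • outer (x j) := by
        rw [Finset.sum_eq_single_of_mem j hj]
        · simp
        · intro i _ hij
          simp [Pi.single_eq_of_ne hij]
      have h2 : ∑ i ∈ A,
          (((1 - s) • w + s • Pi.single j (1 : ℝ) : Fin K → ℝ) i * N) • outer (x i) =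
          (1 - s) • ∑ i ∈ A, (w i * N) • outer (x i) + s • N • outer (x j) := by
        rw [← h1, Finset.smul_sum, Finset.smul_sum, ← Finset.sum_add_distrib]
        refine Finset.sum_congr rfl fun i _ => ?_
        simp only [Pi.add_apply, Pi.smul_apply, smul_eq_mul]
        module
      rw [hVdef, hW, designMatrix, designMatrix, ← hN, h2]
      module
    rw [heq]
    exact hw hmem
  have h2 : (V⁻¹ * W).trace =
      (lam / c) * V⁻¹.trace + N * ((x j).ofLp ⬝ᵥ (V⁻¹ *ᵥ (x j).ofLp)) := by
    rw [hW, mul_add, Matrix.trace_add, mul_smul_comm, mul_smul_comm, mul_one, Matrix.trace_smul,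
      Matrix.trace_smul, trace_mul_outer, smul_eq_mul, smul_eq_mul]
  -- The regularization contributes a nonnegative trace, so dropping it only weakens tr(V⁻¹W) ≤ d.
  have h3 : 0 ≤ (lam / c) * V⁻¹.trace :=
    mul_nonneg (div_pos hlam hc).le hV.inv.posSemidef.trace_nonneg
  rw [wnorm_sq hV.inv.posSemidef, le_div_iff₀ hN0]
  linarith

/-- The G-optimal value is at most the value of the determinant maximizer. -/
theorem IsOptimalDesign.wnorm_sq_le {x : Fin K → EuclideanSpace ℝ (Fin d)} {T : ℕ} (hT : 0 < T)
    {lam c : ℝ} (hlam : 0 < lam) (hc : 0 < c) {ℓ : ℕ} {A : Finset (Fin K)}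
    {w : Fin K → ℝ} (hw : IsOptimalDesign x T lam c ℓ A w) {j : Fin K} (hj : j ∈ A) :
    wnorm (designMatrix x T lam c ℓ A w)⁻¹ (x j) ^ 2 ≤ d / targetLen T ℓ := by
  obtain ⟨w', hw', h'⟩ := exists_isWeight_quad_le x hT hlam hc ℓ ⟨j, hj⟩
  have : Nonempty A := ⟨⟨j, hj⟩⟩
  calc _ ≤ designValue x T lam c ℓ A w :=
        le_ciSup (f := fun i : A => wnorm (designMatrix x T lam c ℓ A w)⁻¹ (x i) ^ 2)
          (Set.finite_range _).bddAbove ⟨j, hj⟩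
    _ ≤ designValue x T lam c ℓ A w' := hw.2 w' hw'
    _ ≤ _ := ciSup_le fun i => h' i i.2

/-! ### Batch sizes and the number of batches -/

namespace Policy

variable {K : ℕ} (P : Policy K) (T : ℕ) (r : ℕ → ℝ)

theorem played_succ (ℓ : ℕ) : P.played T r (ℓ + 1) = P.played T r ℓ ++ P.pulls T r ℓ := rfl

theorem elapsed_succ (ℓ : ℕ) :
    P.elapsed T r (ℓ + 1) = P.elapsed T r ℓ + (P.pulls T r ℓ).length := by
  rw [elapsed, played_succ, List.length_append, elapsed]

theorem elapsed_mono : Monotone (P.elapsed T r) :=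
  monotone_nat_of_le_succ fun ℓ => by rw [elapsed_succ]; omega

theorem played_prefix {m n : ℕ} (h : m ≤ n) : P.played T r m <+: P.played T r n := by
  induction n, h using Nat.le_induction with
  | base => exact List.prefix_rfl
  | succ n _ ih => exact ih.trans (by rw [played_succ]; exact List.prefix_append _ _)

theorem length_pulls (ℓ : ℕ) : (P.pulls T r ℓ).length = min (T - P.elapsed T r ℓ)
    ((P.arms T r ℓ).map
      (P.pullCount T ℓ (P.elapsed T r ℓ) fun s => r s)).sum := by
  simp [pulls, batch, arms, List.length_flatMap]

theorem elapsed_le (ℓ : ℕ) : P.elapsed T r ℓ ≤ T := by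
  induction ℓ with
  | zero => simp [elapsed, played]
  | succ ℓ ih => rw [elapsed_succ, length_pulls]; omega

theorem mem_arms_of_mem_pulls {ℓ : ℕ} {i : Fin K} (h : i ∈ P.pulls T r ℓ) :
    i ∈ P.arms T r ℓ := by
  have h1 := List.mem_of_mem_take h
  rw [List.mem_flatMap] at h1
  obtain ⟨j, hj, hi⟩ := h1
  rw [List.eq_of_mem_replicate hi]
  exact hj

theorem pulls_eq_nil {ℓ : ℕ} (h : P.elapsed T r ℓ = T) : P.pulls T r ℓ = [] := by
  rw [← List.length_eq_zero_iff, length_pulls]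
  omega

/-- Allows the `T` batches in `allPlayed` to be replaced by the first `batchBound T`. -/
theorem played_eq_of_elapsed_eq {m n : ℕ} (hmn : m ≤ n) (h : P.elapsed T r m = T) :
    P.played T r n = P.played T r m := by
  refine ((P.played_prefix T r hmn).eq_of_length_le ?_).symm
  have := P.elapsed_le T r n
  rw [elapsed] at this h
  omega

end Policy

section

variable {d K : ℕ} {x : Fin K → EuclideanSpace ℝ (Fin d)} {T : ℕ} {lam : ℝ} {P : Policy K}

theorem IsBLAE.arms_nodup (h : IsBLAE x T lam P) {r : ℕ → ℝ} {ℓ : ℕ}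
    (hℓ : P.elapsed T r ℓ < T) : (P.arms T r ℓ).Nodup := by
  cases ℓ with
  | zero => exact (h.init r).1
  | succ ℓ =>
    obtain ⟨_, _, _, _, h1, _⟩ :=
      h.update r ℓ ((P.elapsed_mono T r ℓ.le_succ).trans_lt hℓ)
    exact h1

theorem IsBLAE.arms_ne_nil (h : IsBLAE x T lam P) (hK : 0 < K) {r : ℕ → ℝ} {ℓ : ℕ}
    (hℓ : P.elapsed T r ℓ < T) : P.arms T r ℓ ≠ [] := by
  cases ℓ with
  | zero => exact List.ne_nil_of_mem ((h.init r).2 ⟨0, hK⟩)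
  | succ ℓ =>
    obtain ⟨i, _, _, h1, _⟩ :=
      h.update r ℓ ((P.elapsed_mono T r ℓ.le_succ).trans_lt hℓ)
    rintro h2
    simp [h2] at h1

/-- The intended fractions of the pulls of a batch. -/
theorem sum_fractions {L : List (Fin K)} (hL : L.Nodup) (hne : L ≠ []) {w : Fin K → ℝ} (c : ℝ)
    (hw : IsWeight L.toFinset w) :
    ∑ i ∈ L.toFinset, (c * w i + (1 - c) * (if L.head? = some i then 1 else 0)) = 1 := by
  obtain ⟨i₀, L', rfl⟩ := List.exists_cons_of_ne_nil hne
  rw [Finset.sum_add_distrib, ← Finset.mul_sum, ← Finset.mul_sum, hw.2]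
  simp

/-- The intended fractions add up to 1, and each ceiling adds at most one pull. -/
theorem IsBLAE.sum_pullCount (h : IsBLAE x T lam P) (hK : 0 < K) {r : ℕ → ℝ} {ℓ : ℕ}
    (hℓ : P.elapsed T r ℓ < T) :
    targetLen T (ℓ + 1) ≤
      (((P.arms T r ℓ).map (P.pullCount T ℓ (P.elapsed T r ℓ) fun s => r s)).sum : ℝ) ∧
    (((P.arms T r ℓ).map (P.pullCount T ℓ (P.elapsed T r ℓ) fun s => r s)).sum : ℝ) ≤
      targetLen T (ℓ + 1) + (P.arms T r ℓ).length := by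
  have hnd := h.arms_nodup hℓ
  have hw := (h.design r ℓ hℓ).1
  have hN := (targetLen_pos (T := T) (by omega) (ℓ + 1)).le
  have hs := sum_fractions hnd (h.arms_ne_nil hK hℓ) (P.rateAt T r ℓ) hw
  have hc := h.rate_mem ℓ (P.elapsed T r ℓ) fun s => r s
  have hs' := congrArg (fun z => targetLen T (ℓ + 1) * z) hs
  simp only [mul_one, Finset.mul_sum] at hs'
  rw [← List.sum_toFinset _ hnd, Nat.cast_sum]
  constructor
  · rw [← hs']
    exact Finset.sum_le_sum fun i _ => Nat.le_ceil _
  · rw [← List.toFinset_card_of_nodup hnd, ← nsmul_one, ← Finset.sum_const, ← hs',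
      ← Finset.sum_add_distrib]
    refine Finset.sum_le_sum fun i hi => (Nat.ceil_lt_add_one ?_).le
    refine mul_nonneg hN (add_nonneg (mul_nonneg hc.1.le (hw.1 i hi))
      (mul_nonneg (sub_nonneg.2 hc.2) ?_))
    split_ifs <;> simp

theorem IsBLAE.length_pulls_le (h : IsBLAE x T lam P) (hK : 0 < K) (hT : 0 < T) (r : ℕ → ℝ)
    (ℓ : ℕ) :
    ((P.pulls T r ℓ).length : ℝ) ≤ targetLen T (ℓ + 1) + ((P.arms T r ℓ).length : ℝ) := by
  rcases (P.elapsed_le T r ℓ).eq_or_lt with h1 | h1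
  · rw [P.pulls_eq_nil T r h1]
    have := (targetLen_pos hT (ℓ + 1)).le
    simp only [List.length_nil, Nat.cast_zero]
    positivity
  · refine le_trans ?_ (h.sum_pullCount hK h1).2
    rw [P.length_pulls]
    exact_mod_cast min_le_right _ _

theorem elapsed_lt_of_succ {r : ℕ → ℝ} {ℓ : ℕ} (hℓ : P.elapsed T r (ℓ + 1) < T) :
    P.elapsed T r ℓ < T :=
  (P.elapsed_mono T r ℓ.le_succ).trans_lt hℓ

theorem length_pulls_eq_sum {r : ℕ → ℝ} {ℓ : ℕ} (hℓ : P.elapsed T r (ℓ + 1) < T) :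
    (P.pulls T r ℓ).length = ((P.arms T r ℓ).map
      (P.pullCount T ℓ (P.elapsed T r ℓ) fun s => r s)).sum := by
  have h2 := P.length_pulls T r ℓ
  have h3 := P.elapsed_succ T r ℓ
  omega

theorem IsBLAE.le_length_pulls (h : IsBLAE x T lam P) (hK : 0 < K) {r : ℕ → ℝ} {ℓ : ℕ}
    (hℓ : P.elapsed T r (ℓ + 1) < T) :
    targetLen T (ℓ + 1) ≤ ((P.pulls T r ℓ).length : ℝ) := by
  rw [length_pulls_eq_sum hℓ]
  exact_mod_cast (h.sum_pullCount hK (elapsed_lt_of_succ hℓ)).1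

theorem two_le_batchBound {T : ℕ} (hT : 3 ≤ T) : 2 ≤ batchBound T := by
  have h1 : (3 : ℝ) ≤ T := by exact_mod_cast hT
  have h2 : 1 < Real.logb 2 T := by
    rw [Real.lt_logb_iff_rpow_lt one_lt_two (by linarith)]
    norm_num; linarith
  have h3 : 0 < Real.logb 2 (Real.logb 2 T) := Real.logb_pos one_lt_two h2
  have := Nat.ceil_pos.2 h3
  unfold batchBound
  omega

/-- N_m = T / T^{2^{-m}}, and the denominator is at most 2 as soon as 2^m ≥ log₂ T. -/
theorem half_le_targetLen {T m : ℕ} (hT : 3 ≤ T) (hm : batchBound T ≤ m + 1) :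
    (T : ℝ) / 2 ≤ targetLen T m := by
  have h1 : (3 : ℝ) ≤ T := by exact_mod_cast hT
  have hT0 : (0 : ℝ) < T := by linarith
  have h2 : 1 < Real.logb 2 T := by
    rw [Real.lt_logb_iff_rpow_lt one_lt_two (by linarith)]
    norm_num; linarith
  have h3 : Real.logb 2 (Real.logb 2 T) ≤ m := by
    refine (Nat.le_ceil _).trans ?_
    unfold batchBound at hm
    exact_mod_cast (by omega)
  rw [Real.logb_le_iff_le_rpow one_lt_two (by linarith), Real.rpow_natCast] at h3
  have h4 : (T : ℝ) ≤ (2 : ℝ) ^ ((2 : ℝ) ^ m) :=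
    (Real.logb_le_iff_le_rpow one_lt_two hT0).1 h3
  have h5 : (T : ℝ) ^ ((2 : ℝ) ^ m)⁻¹ ≤ 2 := by
    refine (Real.rpow_le_rpow hT0.le h4 (by positivity)).trans_eq ?_
    rw [← Real.rpow_mul (by norm_num), mul_inv_cancel₀ (by positivity), Real.rpow_one]
  have h6 : ((2 : ℝ) ^ m - 1) / 2 ^ m = 1 - ((2 : ℝ) ^ m)⁻¹ := by
    field_simp
  rw [targetLen, h6, Real.rpow_sub hT0, Real.rpow_one]
  gcongr

theorem batchBound_le {T : ℕ} (hT : 3 ≤ T) : batchBound T ≤ T := by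
  have h1 : (3 : ℝ) ≤ T := by exact_mod_cast hT
  have hT0 : (0 : ℝ) < T := by linarith
  have h2 : 1 < Real.logb 2 T := by
    rw [Real.lt_logb_iff_rpow_lt one_lt_two (by linarith)]
    norm_num; linarith
  have h3 : ⌈Real.logb 2 (Real.logb 2 T)⌉₊ ≤ T - 1 := by
    rw [Nat.ceil_le, Real.logb_le_iff_le_rpow one_lt_two (by linarith),
      Real.logb_le_iff_le_rpow one_lt_two hT0, Real.rpow_natCast]
    have h4 : T < 2 ^ T := Nat.lt_two_pow_self
    have h5 : T ≤ 2 ^ (T - 1) := by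
      have := Nat.lt_two_pow_self (n := T - 1)
      omega
    calc (T : ℝ) ≤ (2 : ℝ) ^ T := by exact_mod_cast h4.le
      _ = (2 : ℝ) ^ ((T : ℕ) : ℝ) := (Real.rpow_natCast _ _).symm
      _ ≤ (2 : ℝ) ^ ((2 : ℝ) ^ (T - 1)) :=
        Real.rpow_le_rpow_of_exponent_le one_le_two (by exact_mod_cast h5)
  unfold batchBound
  omega

/-- If rounds were left after b batches, the last two of these would be complete and of length at
least T/2 each. -/
theorem IsBLAE.elapsed_batchBound (h : IsBLAE x T lam P) (hK : 0 < K) (hT : 3 ≤ T) (r : ℕ → ℝ) :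
    P.elapsed T r (batchBound T) = T := by
  by_contra hne
  have hlt := lt_of_le_of_ne (P.elapsed_le T r _) hne
  obtain ⟨m, hm⟩ : ∃ m, batchBound T = m + 2 := ⟨batchBound T - 2, by
    have := two_le_batchBound hT
    omega⟩
  rw [hm] at hlt
  have hlt' := elapsed_lt_of_succ hlt
  have h1 := h.le_length_pulls hK hlt
  have h2 := h.le_length_pulls hK hlt'
  have h3 := half_le_targetLen (m := m + 2) hT (by omega)
  have h4 := half_le_targetLen (m := m + 1) hT (by omega)
  have h5 := P.elapsed_succ T r (m + 1)
  have h6 := P.elapsed_succ T r m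
  have h7 : (T : ℝ) ≤ P.elapsed T r (m + 2) := by
    rw [h5, h6]
    push_cast
    linarith
  have h8 : T ≤ P.elapsed T r (m + 2) := by exact_mod_cast h7
  omega

theorem IsBLAE.allPlayed_eq (h : IsBLAE x T lam P) (hK : 0 < K) (hT : 3 ≤ T) (r : ℕ → ℝ) :
    P.allPlayed T r = P.played T r (batchBound T) :=
  P.played_eq_of_elapsed_eq T r (batchBound_le hT) (h.elapsed_batchBound hK hT r)

/-- The arms of a complete batch contain the rounded optimal design. -/
theorem IsBLAE.le_gram_quad (h : IsBLAE x T lam P) (hlam : 0 < lam) {r : ℕ → ℝ} {ℓ : ℕ}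
    (hℓ : P.elapsed T r (ℓ + 1) < T) (u : Fin d → ℝ) :
    P.rateAt T r ℓ * (u ⬝ᵥ (designMatrix x T lam (P.rateAt T r ℓ) (ℓ + 1)
      (P.arms T r ℓ).toFinset (P.weightAt T r ℓ) *ᵥ u)) ≤
    u ⬝ᵥ (gram x lam (P.pulls T r ℓ) *ᵥ u) := by
  have hℓ' := elapsed_lt_of_succ hℓ
  have hc : P.rateAt T r ℓ ∈ Set.Ioc (0 : ℝ) 1 := h.rate_mem ℓ _ _
  have hN := (targetLen_pos (T := T) (by omega) (ℓ + 1)).le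
  -- A batch after which rounds remain was not cut off, so `take` does nothing.
  have hpulls : P.pulls T r ℓ = (P.arms T r ℓ).flatMap fun i =>
      List.replicate (P.pullCount T ℓ (P.elapsed T r ℓ) (fun s => r s) i) i := by
    refine List.take_of_length_le ?_
    have h2 := P.elapsed_succ T r ℓ
    have h3 := length_pulls_eq_sum hℓ
    simp only [List.length_flatMap, List.length_replicate]
    change ((P.arms T r ℓ).map (P.pullCount T ℓ (P.elapsed T r ℓ) fun s => r s)).sum ≤ _
    omega
  have hsum : ∀ (L : List (Fin K)) (n : Fin K → ℕ),
      ((L.flatMap fun i => List.replicate (n i) i).map fun i => (u ⬝ᵥ (x i).ofLp) ^ 2).sum =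
        (L.map fun i => (n i : ℝ) * (u ⬝ᵥ (x i).ofLp) ^ 2).sum := by
    intro L n
    induction L with
    | nil => simp
    | cons i L ih => simp [ih]
  rw [gram_quad, hpulls, hsum, ← List.sum_toFinset _ (h.arms_nodup hℓ'), designMatrix,
    Matrix.add_mulVec, dotProduct_add, mul_add]
  refine add_le_add (le_of_eq ?_) ?_
  · have := hc.1.ne'
    rw [Matrix.smul_mulVec, Matrix.one_mulVec, dotProduct_smul, smul_eq_mul]
    field_simp
  · rw [Matrix.sum_mulVec, dotProduct_sum, Finset.mul_sum]
    refine Finset.sum_le_sum fun i hi => ?_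
    rw [Matrix.smul_mulVec, dotProduct_smul, quad_outer, smul_eq_mul, ← mul_assoc]
    refine mul_le_mul_of_nonneg_right ?_ (sq_nonneg _)
    -- Only the share c_ℓ π_i N_ℓ of the pulls is kept; the rounding and the extra pulls of the
    -- first arm are dropped.
    refine le_trans ?_ (Nat.le_ceil _)
    rw [mul_left_comm, mul_comm, mul_assoc, mul_comm]
    refine (mul_le_mul_of_nonneg_left (le_add_of_nonneg_right ?_) hN).trans_eq' ?_
    · refine mul_nonneg (sub_nonneg.2 hc.2) ?_
      split_ifs <;> simp
    · simp only [Policy.weightAt, Policy.rateAt]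
      ring

/-- Inversion turns H_ℓ ≥ c_ℓ V_ℓ into an upper bound, to which the design bound applies. -/
theorem IsBLAE.wnorm_le (h : IsBLAE x T lam P) (hlam : 0 < lam) {cmin : ℝ} (hcmin : 0 < cmin)
    (hrate : ∀ ℓ t h, cmin ≤ P.rate ℓ t h) {r : ℕ → ℝ} {ℓ : ℕ}
    (hℓ : P.elapsed T r (ℓ + 1) < T) {i : Fin K} (hi : i ∈ P.arms T r ℓ) :
    wnorm (gram x lam (P.pulls T r ℓ))⁻¹ (x i) ^ 2 ≤ cmin⁻¹ * (d / targetLen T (ℓ + 1)) := by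
  have hℓ' := elapsed_lt_of_succ hℓ
  have hT : 0 < T := by omega
  have hc : P.rateAt T r ℓ ∈ Set.Ioc (0 : ℝ) 1 := h.rate_mem ℓ _ _
  have hd := h.design r ℓ hℓ'
  have hV := designMatrix_posDef x hT hlam hc.1 (ℓ + 1) hd.1.1
  have hH := gram_posDef x hlam (P.pulls T r ℓ)
  have h1 := PosDef.quad_inv_le hH hV hc.1 (h.le_gram_quad hlam hℓ) (x i).ofLp
  have h2 := hd.wnorm_sq_le hT hlam hc.1 (List.mem_toFinset.2 hi)
  rw [wnorm_sq hV.inv.posSemidef] at h2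
  rw [wnorm_sq hH.inv.posSemidef]
  have h3 := PosSemidef.quad_nonneg hV.inv.posSemidef (x i).ofLp
  refine h1.trans ?_
  gcongr
  exact hrate _ _ _

theorem IsBLAE.iSup_wnorm_le (h : IsBLAE x T lam P) (hK : 0 < K) (hlam : 0 < lam) {cmin : ℝ}
    (hcmin : 0 < cmin)
    (hrate : ∀ ℓ t h, cmin ≤ P.rate ℓ t h) {r : ℕ → ℝ} {ℓ : ℕ}
    (hℓ : P.elapsed T r (ℓ + 1) < T) :
    (⨆ p : (P.arms T r ℓ).toFinset × (P.arms T r ℓ).toFinset,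
      wnorm (gram x lam (P.pulls T r ℓ))⁻¹ (x p.1 - x p.2)) ≤
      2 * √cmin⁻¹ * √(d / targetLen T (ℓ + 1)) := by
  have hℓ' := elapsed_lt_of_succ hℓ
  obtain ⟨i₀, hi₀⟩ := List.exists_mem_of_ne_nil _ (h.arms_ne_nil hK hℓ')
  have : Nonempty (P.arms T r ℓ).toFinset := ⟨⟨i₀, List.mem_toFinset.2 hi₀⟩⟩
  refine ciSup_le fun p => ?_
  have h1 := h.wnorm_le hlam hcmin hrate hℓ (List.mem_toFinset.1 p.1.2)
  have h2 := h.wnorm_le hlam hcmin hrate hℓ (List.mem_toFinset.1 p.2.2)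
  have h3 := wnorm_sub_sq_le (gram_posDef x hlam (P.pulls T r ℓ)).inv.posSemidef (x p.1) (x p.2)
  refine le_of_sq_le_sq ?_ (by positivity)
  have hN := targetLen_pos (T := T) (by omega) (ℓ + 1)
  rw [mul_pow, mul_pow, Real.sq_sqrt (by positivity), Real.sq_sqrt (by positivity)]
  linarith

end

/-! ### Logarithmic factors and the order of the thresholds -/

theorem one_lt_log {T : ℕ} (hT : 3 ≤ T) : 1 < Real.log T := by
  have h1 : (3 : ℝ) ≤ T := by exact_mod_cast hT
  rw [Real.lt_log_iff_exp_lt (by linarith)]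
  linarith [Real.exp_one_lt_d9]

theorem log_log_three_pos : 0 < Real.log (Real.log 3) :=
  Real.log_pos (by exact_mod_cast one_lt_log le_rfl)

theorem log_log_three_le {T : ℕ} (hT : 3 ≤ T) :
    Real.log (Real.log 3) ≤ Real.log (Real.log T) := by
  have h1 : (3 : ℝ) ≤ T := by exact_mod_cast hT
  have h2 : 1 < Real.log 3 := by exact_mod_cast one_lt_log le_rfl
  gcongr

/-- For T ≥ 3 the quantity log log T stays above the positive number log log 3, so a multiple of it
absorbs the additive constants. -/
theorem exists_batchBound_le :
    ∃ B : ℝ, 0 < B ∧ ∀ T : ℕ, 3 ≤ T → (batchBound T : ℝ) ≤ B * Real.log (Real.log T) := by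
  have hκ := log_log_three_pos
  set κ := Real.log (Real.log 3)
  have hl2 : 0 < Real.log 2 := Real.log_pos one_lt_two
  have hll2 : Real.log (Real.log 2) ≤ 0 :=
    Real.log_nonpos hl2.le (by linarith [Real.log_two_lt_d9])
  refine ⟨(2 - Real.log (Real.log 2) / Real.log 2) / κ + 1 / Real.log 2, ?_, fun T hT => ?_⟩
  · have : Real.log (Real.log 2) / Real.log 2 ≤ 0 := div_nonpos_of_nonpos_of_nonneg hll2 hl2.le
    have : 0 < 2 - Real.log (Real.log 2) / Real.log 2 := by linarith
    positivity
  · have h1 : (3 : ℝ) ≤ T := by exact_mod_cast hT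
    have hlT := one_lt_log hT
    have h2 : 1 < Real.logb 2 T := by
      rw [Real.lt_logb_iff_rpow_lt one_lt_two (by linarith)]
      norm_num; linarith
    have h3 : (batchBound T : ℝ) ≤ 2 + Real.logb 2 (Real.logb 2 T) := by
      have := Nat.ceil_lt_add_one (Real.logb_nonneg one_lt_two h2.le)
      rw [batchBound]
      push_cast
      linarith
    have h4 : Real.logb 2 (Real.logb 2 T) =
        Real.log (Real.log T) / Real.log 2 - Real.log (Real.log 2) / Real.log 2 := by
      rw [Real.logb, Real.logb, Real.log_div (by linarith) hl2.ne']
      ring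
    have h5 : Real.log (Real.log 2) / Real.log 2 ≤ 0 := div_nonpos_of_nonpos_of_nonneg hll2 hl2.le
    have h6 : 1 ≤ Real.log (Real.log T) / κ := (one_le_div hκ).2 (log_log_three_le hT)
    calc (batchBound T : ℝ)
        ≤ (2 - Real.log (Real.log 2) / Real.log 2) * 1 + Real.log (Real.log T) / Real.log 2 := by
          linarith
      _ ≤ (2 - Real.log (Real.log 2) / Real.log 2) * (Real.log (Real.log T) / κ) +
          Real.log (Real.log T) / Real.log 2 := by
          gcongr
          linarith
      _ = _ := by ring

section

variable {d K T : ℕ}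

theorem one_le_log_mul (hK : 2 ≤ K) (hT : 3 ≤ T) : 1 ≤ Real.log ((K : ℝ) * T) := by
  have hK' : (2 : ℝ) ≤ K := by exact_mod_cast hK
  have hT' : (3 : ℝ) ≤ T := by exact_mod_cast hT
  have := one_lt_log hT
  rw [Real.log_mul (by linarith) (by linarith)]
  linarith [Real.log_nonneg (by linarith : (1 : ℝ) ≤ K)]

theorem radiusSmall_le {lam lamMax : ℝ} (hle : lam ≤ lamMax) (hK : 2 ≤ K) (hT : 3 ≤ T)
    {n : ℕ} (hn : 2 ≤ n) (hnK : n ≤ K) :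
    radiusSmall n T lam (1 / T) ≤ (2 + √lamMax) * √(Real.log ((K : ℝ) * T)) := by
  have hK' : (2 : ℝ) ≤ K := by exact_mod_cast hK
  have hT' : (3 : ℝ) ≤ T := by exact_mod_cast hT
  have hn' : (2 : ℝ) ≤ n := by exact_mod_cast hn
  have hnK' : (n : ℝ) ≤ K := by exact_mod_cast hnK
  have hb : (2 : ℝ) ≤ batchBound T := by exact_mod_cast two_le_batchBound hT
  have hb' : (batchBound T : ℝ) ≤ T := by exact_mod_cast batchBound_le hT
  have hKT := one_le_log_mul hK hT
  -- The argument of the logarithm is (n² - n) b T ≤ (KT)², because n ≤ K and b ≤ T.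
  have h1 : Real.log (((n : ℝ) ^ 2 - n) / (1 / T / (batchBound T : ℝ))) ≤
      2 * Real.log ((K : ℝ) * T) := by
    have h2 : ((n : ℝ) ^ 2 - n) / (1 / T / (batchBound T : ℝ)) =
        ((n : ℝ) ^ 2 - n) * (batchBound T * T) := by field_simp
    have h3 : 0 < (n : ℝ) ^ 2 - n := by nlinarith
    have h4 : 2 * Real.log ((K : ℝ) * T) = Real.log (((K : ℝ) * T) ^ 2) := by
      rw [Real.log_pow]; norm_num
    rw [h2, h4]
    refine Real.log_le_log (by positivity) ?_
    rw [mul_pow, sq (T : ℝ)]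
    gcongr
    nlinarith
  have h5 : 1 ≤ √(Real.log ((K : ℝ) * T)) := Real.one_le_sqrt.2 hKT
  have h6 : √(2 * Real.log (((n : ℝ) ^ 2 - n) / (1 / T / (batchBound T : ℝ)))) ≤
      2 * √(Real.log ((K : ℝ) * T)) := by
    rw [Real.sqrt_le_left (by positivity), mul_pow, Real.sq_sqrt (by linarith)]
    linarith
  have h7 : √lam ≤ √lamMax * √(Real.log ((K : ℝ) * T)) :=
    (Real.sqrt_le_sqrt hle).trans (le_mul_of_one_le_right (Real.sqrt_nonneg _) h5)
  rw [radiusSmall]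
  linarith

theorem radiusLarge_le {lam lamMax : ℝ} (hle : lam ≤ lamMax) (hd : 2 ≤ d) (hT : 3 ≤ T) :
    radiusLarge d T lam (1 / T) ≤ (14 + 2 * √lamMax) * √((d : ℝ) + Real.log T) := by
  have hd' : (2 : ℝ) ≤ d := by exact_mod_cast hd
  have hT' : (3 : ℝ) ≤ T := by exact_mod_cast hT
  have hb : (2 : ℝ) ≤ batchBound T := by exact_mod_cast two_le_batchBound hT
  have hb' : (batchBound T : ℝ) ≤ T := by exact_mod_cast batchBound_le hT
  have hl := one_lt_log hT
  -- 37 = 32 + 5, from log(8πd) ≤ 8πd ≤ 32d and log(64/15) ≤ 5. As 37 ≤ 7², the radius gets the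
  -- factor 14 = 2 · 7.
  have h1 : Real.log (8 * Real.pi * d * (batchBound T : ℝ) ^ 2 /
      ((15 / 64 : ℝ) ^ (d - 1) * (1 / T) ^ 2)) ≤ 37 * (d + Real.log T) := by
    have h2 : 8 * Real.pi * d * (batchBound T : ℝ) ^ 2 /
        ((15 / 64 : ℝ) ^ (d - 1) * (1 / T) ^ 2) =
        8 * Real.pi * d * (64 / 15) ^ (d - 1) * ((batchBound T : ℝ) ^ 2 * T ^ 2) := by
      have : (64 / 15 : ℝ) ^ (d - 1) = ((15 / 64 : ℝ) ^ (d - 1))⁻¹ := by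
        rw [← inv_pow]; norm_num
      rw [this]
      field_simp
    have hpi := Real.pi_pos
    have hpi4 := Real.pi_le_four
    rw [h2]
    calc _ ≤ Real.log (8 * Real.pi * d * (64 / 15) ^ (d - 1) * ((T : ℝ) ^ 2 * T ^ 2)) := by
          refine Real.log_le_log (by positivity) ?_
          gcongr
      _ = Real.log (8 * Real.pi * d) + (d - 1 : ℕ) * Real.log (64 / 15) + 4 * Real.log T := by
          rw [Real.log_mul (by positivity) (by positivity),
            Real.log_mul (x := 8 * Real.pi * d) (by positivity) (by positivity), Real.log_pow,
            ← pow_add, Real.log_pow]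
          norm_num
      _ ≤ 32 * d + d * 5 + 37 * Real.log T := by
          have h3 : Real.log (8 * Real.pi * d) ≤ 32 * d := by
            refine (Real.log_le_self (by positivity)).trans ?_
            nlinarith
          have h4 : Real.log (64 / 15) ≤ 5 :=
            (Real.log_le_self (by norm_num)).trans (by norm_num)
          have h5 : ((d - 1 : ℕ) : ℝ) ≤ d := by exact_mod_cast Nat.sub_le d 1
          have h6 : 0 ≤ Real.log (64 / 15) := Real.log_nonneg (by norm_num)
          have h7 : ((d - 1 : ℕ) : ℝ) * Real.log (64 / 15) ≤ d * 5 := by gcongr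
          linarith
      _ = _ := by ring
  have h5 : 1 ≤ √((d : ℝ) + Real.log T) := Real.one_le_sqrt.2 (by linarith)
  have h6 : √(Real.log (8 * Real.pi * d * (batchBound T : ℝ) ^ 2 /
      ((15 / 64 : ℝ) ^ (d - 1) * (1 / T) ^ 2))) ≤ 7 * √((d : ℝ) + Real.log T) := by
    rw [Real.sqrt_le_left (by positivity), mul_pow, Real.sq_sqrt (by linarith)]
    linarith
  have h7 : √lam ≤ √lamMax * √((d : ℝ) + Real.log T) :=
    (Real.sqrt_le_sqrt hle).trans (le_mul_of_one_le_right (Real.sqrt_nonneg _) h5)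
  rw [radiusLarge]
  linarith

theorem min_radius_le {lam lamMax : ℝ} (hle : lam ≤ lamMax) (hd : 2 ≤ d) (hK : 2 ≤ K) (hT : 3 ≤ T)
    {n : ℕ} (hn : 2 ≤ n) (hnK : n ≤ K) :
    min (radiusLarge d T lam (1 / T)) (radiusSmall n T lam (1 / T)) ≤
      (14 + 2 * √lamMax) * logFactor d K T := by
  have h0 : 0 ≤ √lamMax := Real.sqrt_nonneg _
  rw [logFactor, mul_min_of_nonneg _ _ (by positivity), min_comm]
  refine min_le_min ((radiusSmall_le hle hK hT hn hnK).trans ?_) (radiusLarge_le hle hd hT)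
  gcongr <;> linarith

theorem one_le_logFactor (hd : 2 ≤ d) (hK : 2 ≤ K) (hT : 3 ≤ T) : 1 ≤ logFactor d K T := by
  have hd' : (2 : ℝ) ≤ d := by exact_mod_cast hd
  have := one_lt_log hT
  exact le_min (Real.one_le_sqrt.2 (one_le_log_mul hK hT)) (Real.one_le_sqrt.2 (by linarith))

/-- Together with `card_le_of_horizon` this bounds the rounding cost K by the main term. -/
theorem sqrt_min_le_logFactor (hK : 2 ≤ K) (hT : 3 ≤ T) :
    √(min (d : ℝ) (Real.log K)) ≤ logFactor d K T := by
  have hK' : (2 : ℝ) ≤ K := by exact_mod_cast hK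
  have hT' : (3 : ℝ) ≤ T := by exact_mod_cast hT
  have := one_lt_log hT
  refine le_min (Real.sqrt_le_sqrt ((min_le_right _ _).trans ?_))
    (Real.sqrt_le_sqrt ((min_le_left _ _).trans (by linarith)))
  rw [Real.log_mul (by linarith) (by linarith)]
  linarith

/-- As d, log T ≥ 1 and log K ≥ 1/2, the sums d + log T and log K + log T are at most four times the
corresponding products. -/
theorem logFactor_le (hd : 2 ≤ d) (hK : 2 ≤ K) (hT : 3 ≤ T) :
    logFactor d K T ≤ 2 * √(min (d : ℝ) (Real.log K)) * √(Real.log T) := by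
  have hd' : (2 : ℝ) ≤ d := by exact_mod_cast hd
  have hK' : (2 : ℝ) ≤ K := by exact_mod_cast hK
  have hT' : (3 : ℝ) ≤ T := by exact_mod_cast hT
  have hl := one_lt_log hT
  have hk : 1 / 2 ≤ Real.log K :=
    (by linarith [Real.log_two_gt_d9] : (1 / 2 : ℝ) ≤ Real.log 2).trans
      (Real.log_le_log (by norm_num) hK')
  rw [mul_assoc, ← Real.sqrt_mul (by positivity)]
  rcases min_cases (d : ℝ) (Real.log K) with ⟨h, _⟩ | ⟨h, _⟩ <;> rw [h]
  · refine (min_le_right _ _).trans ?_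
    rw [Real.sqrt_le_left (by positivity), mul_pow, Real.sq_sqrt (by positivity)]
    nlinarith
  · refine (min_le_left _ _).trans ?_
    rw [Real.sqrt_le_left (by positivity), mul_pow, Real.sq_sqrt (by positivity),
      Real.log_mul (by linarith) (by linarith)]
    nlinarith

theorem sqrt_mul_log_le {u : ℝ} (hu : 0 < u) : √u * Real.log u ≤ 2 * u := by
  have h1 : Real.log u = 2 * Real.log (√u) := by rw [Real.log_sqrt hu.le]; ring
  have h2 := Real.log_le_self (Real.sqrt_nonneg u)
  have h3 := Real.mul_self_sqrt hu.le
  nlinarith [Real.sqrt_nonneg u]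

theorem sqrt_mul_sqrt_min (d K T : ℕ) : √((d : ℝ) * T) * √(min (d : ℝ) (Real.log K)) =
    min (√((d : ℝ) * T * Real.log K)) ((d : ℝ) * √(T : ℝ)) := by
  have h : √((d : ℝ) * T) * √(d : ℝ) = d * √(T : ℝ) := by
    rw [Real.sqrt_mul (by positivity), mul_right_comm, Real.mul_self_sqrt (by positivity)]
  rw [Monotone.map_min (f := Real.sqrt) (fun _ _ => Real.sqrt_le_sqrt),
    mul_min_of_nonneg _ _ (Real.sqrt_nonneg _), h, ← Real.sqrt_mul (by positivity), min_comm]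

/-- Combine `logFactor_le` with `sqrt_mul_log_le` at u = log T. -/
theorem first_rate_le_second_rate (hd : 2 ≤ d) (hK : 2 ≤ K) (hT : 3 ≤ T) :
    √((d : ℝ) * T) * logFactor d K T * Real.log (Real.log T) ≤
      4 * (min (√((d : ℝ) * T * Real.log K)) ((d : ℝ) * √(T : ℝ)) * Real.log T) := by
  have hl := one_lt_log hT
  have h1 := sqrt_mul_log_le (zero_lt_one.trans hl)
  rw [← sqrt_mul_sqrt_min]
  calc √((d : ℝ) * T) * logFactor d K T * Real.log (Real.log T)
      ≤ √((d : ℝ) * T) * (2 * √(min (d : ℝ) (Real.log K)) * √(Real.log T)) *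
          Real.log (Real.log T) := by
        gcongr
        · exact Real.log_nonneg hl.le
        · exact logFactor_le hd hK hT
    _ = √((d : ℝ) * T) * √(min (d : ℝ) (Real.log K)) * 2 *
        (√(Real.log T) * Real.log (Real.log T)) := by ring
    _ ≤ √((d : ℝ) * T) * √(min (d : ℝ) (Real.log K)) * 2 * (2 * Real.log T) := by gcongr
    _ = _ := by ring

theorem card_le_of_horizon {a : ℝ} (ha : 0 < a) (hd : 2 ≤ d) (hK : 2 ≤ K)
    (h : a * ((K : ℝ) ^ 2 / (min (d : ℝ) (Real.log K) * d)) ≤ T) :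
    (K : ℝ) ≤ √a⁻¹ * (√((d : ℝ) * T) * √(min (d : ℝ) (Real.log K))) := by
  have hd' : (2 : ℝ) ≤ d := by exact_mod_cast hd
  have hK' : (2 : ℝ) ≤ K := by exact_mod_cast hK
  have hm : 0 < min (d : ℝ) (Real.log K) :=
    lt_min (by linarith) (Real.log_pos (by linarith))
  rw [← Real.sqrt_mul (by positivity), ← Real.sqrt_mul (by positivity)]
  refine Real.le_sqrt_of_sq_le ?_
  rw [mul_div_assoc', div_le_iff₀ (by positivity)] at h
  rw [inv_mul_eq_div, le_div_iff₀ ha]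
  linarith

/-- The product of the length of a batch and of the threshold of the batch before. -/
theorem targetLen_mul_thresholdOrder (hT : 3 ≤ T) (ℓ : ℕ) :
    targetLen T (ℓ + 1) * thresholdOrder d K T ℓ = √((d : ℝ) * T) * logFactor d K T := by
  have hT' : (0 : ℝ) < T := by exact_mod_cast (by omega)
  rw [thresholdOrder, targetLen, ← mul_assoc]
  congr 1
  -- The powers of T combine to (1 - 2^{-(ℓ+1)}) - (1 - 2^{-ℓ})/2 = 1/2.
  rw [Real.sqrt_mul (by positivity), Real.sqrt_mul (by positivity), Real.sqrt_eq_rpow (_ ^ _),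
    ← Real.rpow_mul hT'.le, mul_left_comm, ← Real.rpow_add hT', Real.sqrt_eq_rpow (T : ℝ)]
  congr 2
  rw [pow_succ]
  field_simp
  ring

theorem targetLen_one_le (hd : 2 ≤ d) (hK : 2 ≤ K) (hT : 3 ≤ T) :
    targetLen T 1 ≤ √((d : ℝ) * T) * logFactor d K T := by
  have hd' : (2 : ℝ) ≤ d := by exact_mod_cast hd
  have hT' : (0 : ℝ) < T := by exact_mod_cast (by omega)
  have h1 : targetLen T 1 = √T := by
    rw [targetLen, Real.sqrt_eq_rpow]; norm_num
  rw [h1]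
  exact (Real.sqrt_le_sqrt (by nlinarith)).trans
    (le_mul_of_one_le_right (Real.sqrt_nonneg _) (one_le_logFactor hd hK hT))

theorem thresholdOrder_eq (hT : 3 ≤ T) (ℓ : ℕ) :
    √((d : ℝ) / targetLen T ℓ) * logFactor d K T = thresholdOrder d K T ℓ := by
  rw [thresholdOrder, targetLen, Real.rpow_neg (by positivity), div_eq_mul_inv]

theorem thresholdOrder_nonneg (ℓ : ℕ) : 0 ≤ thresholdOrder d K T ℓ :=
  mul_nonneg (Real.sqrt_nonneg _) (le_min (Real.sqrt_nonneg _) (Real.sqrt_nonneg _))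

end

/-! ### The order of the confidence width -/

section

variable {d K : ℕ} {x : Fin K → EuclideanSpace ℝ (Fin d)} {T : ℕ} {lam : ℝ} {P : Policy K}

/-- The confidence width has the order of the threshold. -/
theorem IsBLAE.confWidth_le (h : IsBLAE x T lam P) (hd : 2 ≤ d) (hK : 2 ≤ K) (hT : 3 ≤ T)
    (hlam : 0 < lam) {lamMax cmin : ℝ} (hle : lam ≤ lamMax) (hcmin : 0 < cmin)
    (hrate : ∀ ℓ t h, cmin ≤ P.rate ℓ t h) {r : ℕ → ℝ} {ℓ : ℕ}
    (hℓ : P.elapsed T r (ℓ + 1) < T) :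
    confWidth x T lam (P.arms T r ℓ).toFinset (P.pulls T r ℓ) ≤
      2 * √cmin⁻¹ * (14 + 2 * √lamMax) * thresholdOrder d K T (ℓ + 1) := by
  have hℓ' := elapsed_lt_of_succ hℓ
  have hne := h.arms_ne_nil (by omega) hℓ'
  have hC : 0 ≤ 2 * √cmin⁻¹ * (14 + 2 * √lamMax) * thresholdOrder d K T (ℓ + 1) := by
    have := thresholdOrder_nonneg (d := d) (K := K) (T := T) (ℓ + 1)
    positivity
  obtain ⟨i₀, hi₀⟩ := List.exists_mem_of_ne_nil _ hne
  have hi₀' := List.mem_toFinset.2 hi₀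
  -- The bound on the radius needs two remaining arms; with fewer, all differences vanish and so
  -- does the width.
  rcases Nat.lt_or_ge (P.arms T r ℓ).toFinset.card 2 with h1 | h1
  · have h2 : ∀ p : (P.arms T r ℓ).toFinset × (P.arms T r ℓ).toFinset,
        wnorm (gram x lam (P.pulls T r ℓ))⁻¹ (x p.1 - x p.2) = 0 := by
      intro p
      rw [Finset.card_le_one.1 (by omega : (P.arms T r ℓ).toFinset.card ≤ 1) p.1 p.1.2 p.2 p.2.2,
        sub_self, wnorm]
      simp
    rw [confWidth]
    simp only [h2, Real.iSup_const_zero, zero_mul]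
    exact hC
  · have h2 := h.iSup_wnorm_le (by omega) hlam hcmin hrate hℓ
    have h3 := min_radius_le (T := T) hle hd hK hT h1
      ((Finset.card_le_univ _).trans_eq (Fintype.card_fin K))
    have h4 := one_le_logFactor hd hK hT
    rw [confWidth, ← thresholdOrder_eq hT]
    calc _ ≤ (2 * √cmin⁻¹ * √(d / targetLen T (ℓ + 1))) *
          ((14 + 2 * √lamMax) * logFactor d K T) :=
          mul_le_mul h2 h3 (le_min (by unfold radiusLarge; positivity)
            (by unfold radiusSmall; positivity)) (by positivity)
      _ = _ := by ring

theorem IsBLAE.exists_numBatches (h : IsBLAE x T lam P) (hK : 0 < K) (hT : 3 ≤ T) {B : ℝ}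
    (hB : (batchBound T : ℝ) ≤ B * Real.log (Real.log T)) (r : ℕ → ℝ) :
    ∃ n : ℕ, n ≤ T ∧ (n : ℝ) ≤ B * Real.log (Real.log T) ∧ P.elapsed T r n = T :=
  ⟨batchBound T, batchBound_le hT, hB, h.elapsed_batchBound hK hT r⟩

end

/-! ### Measurability of the history -/

section

variable {d K : ℕ} {x : Fin K → EuclideanSpace ℝ (Fin d)} {T : ℕ} {lam : ℝ} {P : Policy K}

theorem getElem?_of_isPrefix {α : Type*} {l₁ l₂ : List α} (h : l₁ <+: l₂) {s : ℕ} {a : α}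
    (hs : l₁[s]? = some a) : l₂[s]? = some a := by
  obtain ⟨t, rfl⟩ := h
  rw [List.getElem?_append_left (List.getElem?_eq_some_iff.1 hs).1]
  exact hs

/-- Cut the set along the countably many values of `f`; on each piece `f` is constant. -/
theorem measurableSet_of_discrete_fiber {α β : Type*} [MeasurableSpace α] [Countable β]
    {f : α → β} (hf : ∀ b, MeasurableSet {a | f a = b}) {p : α → β → Prop}
    (hp : ∀ b, MeasurableSet {a | p a b}) : MeasurableSet {a | p a (f a)} := by
  have : {a | p a (f a)} = ⋃ b, {a | f a = b} ∩ {a | p a b} := by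
    ext a
    simp
  rw [this]
  exact MeasurableSet.iUnion fun b => (hf b).inter (hp b)

/-- Once the order is fixed, the batch depends only on the pull counts, a measurable map into a
countable space. -/
theorem IsBLAE.measurableSet_order_batch (h : IsBLAE x T lam P) (ℓ t : ℕ)
    (p : List (Fin K) → List (Fin K) → Prop) :
    MeasurableSet {h : Fin t → ℝ | p (P.order ℓ t h) (P.batch T ℓ t h)} := by
  let count : List (Fin K) → (Fin t → ℝ) → Fin K → ℕ := fun L h i =>
    ⌈targetLen T (ℓ + 1) * (P.rate ℓ t h * P.weight ℓ t h i +
      (1 - P.rate ℓ t h) * (if L.head? = some i then 1 else 0))⌉₊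
  have hcount : ∀ L, Measurable (count L) := fun L => by
    refine measurable_pi_lambda _ fun i => ?_
    have h1 := h.measurable_rate ℓ t
    have h2 : Measurable fun h => P.weight ℓ t h i :=
      (measurable_pi_apply i).comp (h.measurable_weight ℓ t)
    fun_prop
  refine measurableSet_of_discrete_fiber (f := P.order ℓ t)
    (p := fun h L => p L ((L.flatMap fun i => List.replicate (count L h i) i).take (T - t)))
    (h.measurable_order ℓ t) fun L => ?_
  exact hcount L (t := {c | p L ((L.flatMap fun i => List.replicate (c i) i).take (T - t))})
    (Set.to_countable _).measurableSet

/-- Whether `L` is the list of the arms played in the first `ℓ` batches is decided by the rewards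
in the rounds of `L`. -/
theorem IsBLAE.exists_measurableSet_played (h : IsBLAE x T lam P) (ℓ : ℕ) (L : List (Fin K)) :
    ∃ D : Set (Fin L.length → ℝ), MeasurableSet D ∧
      ∀ r : ℕ → ℝ, P.played T r ℓ = L ↔ (fun s : Fin L.length => r s) ∈ D := by
  induction ℓ generalizing L with
  | zero =>
    refine ⟨{_h | [] = L}, MeasurableSet.const _, fun r => ?_⟩
    simp [Policy.played]
  | succ ℓ ih =>
    choose D hD hDr using ih
    -- `k` is the number of rounds in the first `ℓ` batches: `L` splits there into the earlier
    -- batches and the new one.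
    refine ⟨⋃ k : Fin (L.length + 1),
      (fun h (s : Fin (L.take k).length) =>
          h ⟨s, s.2.trans_le (List.length_take_le' _ _)⟩) ⁻¹' D (L.take k) ∩
      (fun h (s : Fin (L.take k).length) =>
          h ⟨s, s.2.trans_le (List.length_take_le' _ _)⟩) ⁻¹'
        {h' | P.batch T ℓ (L.take k).length h' = L.drop k}, ?_, fun r => ?_⟩
    · refine MeasurableSet.iUnion fun k => ?_
      have hm : Measurable fun (h : Fin L.length → ℝ) (s : Fin (L.take k).length) =>
          h ⟨s, s.2.trans_le (List.length_take_le' _ _)⟩ := by fun_prop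
      exact (hm (hD _)).inter (hm (h.measurableSet_order_batch ℓ _ fun _ b => b = L.drop k))
    · rw [Policy.played_succ]
      simp only [Set.mem_iUnion, Set.mem_inter_iff, Set.mem_preimage]
      constructor
      · intro hL
        have hlen : (P.played T r ℓ).length ≤ L.length := by simp [← hL]
        have h1 : L.take (P.played T r ℓ).length = P.played T r ℓ := by simp [← hL]
        have h2 : L.drop (P.played T r ℓ).length = P.pulls T r ℓ := by simp [← hL]
        refine ⟨⟨(P.played T r ℓ).length, by omega⟩, ?_, ?_⟩
        · exact (hDr (L.take (P.played T r ℓ).length) r).1 h1.symm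
        · change P.batch T ℓ (L.take (P.played T r ℓ).length).length (fun s => r s) =
            L.drop (P.played T r ℓ).length
          rw [h1, h2]
          rfl
      · rintro ⟨k, h1, h2⟩
        have h1' := (hDr (L.take k) r).2 h1
        have h2' : P.batch T ℓ (L.take k).length (fun s => r s) = L.drop k := h2
        rw [Policy.pulls, Policy.elapsed, h1', h2', List.take_append_drop]

/-- The decisions in batch `ℓ + 1` are a function of the rewards of the earlier batches. -/
theorem IsBLAE.exists_measurableSet_state (h : IsBLAE x T lam P) (ℓ : ℕ) (L A b : List (Fin K)) :
    ∃ D : Set (Fin L.length → ℝ), MeasurableSet D ∧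
      ∀ r : ℕ → ℝ, (P.played T r ℓ = L ∧ P.arms T r ℓ = A ∧ P.pulls T r ℓ = b) ↔
        (fun s : Fin L.length => r s) ∈ D := by
  obtain ⟨D, hD, hDr⟩ := h.exists_measurableSet_played ℓ L
  refine ⟨D ∩ {h | P.order ℓ L.length h = A ∧ P.batch T ℓ L.length h = b},
    hD.inter (h.measurableSet_order_batch ℓ _ fun o b' => o = A ∧ b' = b), fun r => ?_⟩
  rw [Set.mem_inter_iff, ← hDr r]
  refine and_congr_right fun hL => ?_
  subst hL
  rfl

/-- Replacing the rewards by the ones which the list of pulled arms predicts changes nothing. -/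
theorem played_eq_iff_of_rewards {r r' : ℕ → ℝ} {f : Fin K → ℕ → ℝ} {ℓ : ℕ} {L : List (Fin K)}
    (hr : ∀ s i, (P.played T r ℓ)[s]? = some i → r s = f i s)
    (hr' : ∀ s i, L[s]? = some i → r' s = f i s) (hL : P.played T r' ℓ = L) :
    P.played T r ℓ = L := by
  -- If the first k batches agree, both reward sequences equal `f` along them, and so the next batch
  -- agrees too.
  have key : ∀ k ≤ ℓ, P.played T r k = P.played T r' k := by
    intro k hk
    induction k with
    | zero => rfl
    | succ k ih =>
      have ih := ih (by omega)
      have h1 : ∀ s : Fin (P.played T r' k).length, r s = r' s := by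
        intro s
        have h2 : (P.played T r' k)[(s : ℕ)]? = some ((P.played T r' k)[(s : ℕ)]) :=
          List.getElem?_eq_getElem s.2
        have h3 : (P.played T r k)[(s : ℕ)]? = some ((P.played T r' k)[(s : ℕ)]) := by
          rw [ih]; exact h2
        rw [hr s _ (getElem?_of_isPrefix (P.played_prefix T r (by omega : k ≤ ℓ)) h3),
          hr' s _ (hL ▸ getElem?_of_isPrefix (P.played_prefix T r' (by omega : k ≤ ℓ)) h2)]
      change P.played T r k ++ P.batch T k (P.played T r k).length (fun s => r s) =
        P.played T r' k ++ P.batch T k (P.played T r' k).length (fun s => r' s)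
      rw [ih]
      congr 2
      funext s
      exact h1 s
  rw [key ℓ le_rfl, hL]

end

/-! ### Linear combinations of subgaussian noise -/

section

variable {Ω : Type*} [MeasurableSpace Ω] {μ : Measure Ω} {n : ℕ} {ξ : Fin n → Ω → ℝ}

theorem hasSubgaussianMGF_linear (hind : iIndepFun ξ μ)
    (hsub : ∀ s, HasSubgaussianMGF (ξ s) 1 μ) (a : Fin n → ℝ) {c : ℝ≥0}
    (hc : ∑ s, a s ^ 2 ≤ c) :
    HasSubgaussianMGF (fun ω => ∑ s, a s * ξ s ω) c μ := by
  have h1 : iIndepFun (fun s ω => a s * ξ s ω) μ :=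
    hind.comp (fun s z => a s * z) fun s => measurable_const_mul (a s)
  have h2 := HasSubgaussianMGF.sum_of_iIndepFun (s := Finset.univ) h1
    fun s _ => (hsub s).const_mul (a s)
  refine ⟨h2.integrable_exp_mul, fun t => (h2.mgf_le t).trans (Real.exp_le_exp.2 ?_)⟩
  gcongr
  rw [← NNReal.coe_le_coe]
  refine le_trans (le_of_eq ?_) hc
  rw [NNReal.coe_sum]
  refine Finset.sum_congr rfl fun s _ => ?_
  exact mul_one (a s ^ 2)

theorem lintegral_exp_linear_le (hind : iIndepFun ξ μ)
    (hsub : ∀ s, HasSubgaussianMGF (ξ s) 1 μ) (a : Fin n → ℝ) {c : ℝ} (hc : ∑ s, a s ^ 2 ≤ c) :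
    ∫⁻ ω, ENNReal.ofReal (Real.exp (∑ s, a s * ξ s ω)) ∂μ ≤ ENNReal.ofReal (Real.exp (c / 2)) := by
  have hc0 : 0 ≤ c := (Finset.sum_nonneg fun s _ => sq_nonneg (a s)).trans hc
  have h := hasSubgaussianMGF_linear hind hsub a (c := c.toNNReal)
    (hc.trans_eq (Real.coe_toNNReal c hc0).symm)
  have h1 := h.integrable_exp_mul 1
  have h2 := h.mgf_le 1
  simp only [one_mul] at h1
  rw [← ofReal_integral_eq_lintegral_ofReal h1 (ae_of_all _ fun _ => (Real.exp_pos _).le)]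
  refine ENNReal.ofReal_le_ofReal ?_
  simpa [mgf, hc0] using h2

/-- Chernoff's bound for a linear combination of independent subgaussian variables. -/
theorem measure_linear_gt_le [IsProbabilityMeasure μ] (hind : iIndepFun ξ μ)
    (hsub : ∀ s, HasSubgaussianMGF (ξ s) 1 μ) (a : Fin n → ℝ) {σ ρ : ℝ} (hσ : 0 < σ) (hρ : 0 ≤ ρ)
    (ha : ∑ s, a s ^ 2 ≤ σ ^ 2) :
    μ {ω | σ * ρ ≤ ∑ s, a s * ξ s ω} ≤ ENNReal.ofReal (Real.exp (-ρ ^ 2 / 2)) := by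
  have h := hasSubgaussianMGF_linear hind hsub a (c := (σ ^ 2).toNNReal)
    (ha.trans_eq (Real.coe_toNNReal _ (sq_nonneg σ)).symm)
  have h1 := h.measure_ge_le (mul_nonneg hσ.le hρ)
  rw [← ofReal_measureReal]
  refine ENNReal.ofReal_le_ofReal (h1.trans_eq ?_)
  rw [Real.coe_toNNReal _ (sq_nonneg σ)]
  congr 1
  field_simp

end

/-! ### Gaussian mixtures and self-normalized noise -/

theorem integrable_exp_quadratic {β : ℝ} (hβ : 0 < β) (α : ℝ) :
    Integrable fun z : ℝ => Real.exp (-β * z ^ 2 + α * z) := by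
  have h := ((integrable_exp_neg_mul_sq hβ).comp_sub_right (α / (2 * β))).const_mul
    (Real.exp (α ^ 2 / (4 * β)))
  refine h.congr (ae_of_all _ fun z => ?_)
  simp only
  rw [← Real.exp_add]
  congr 1
  field_simp
  ring

theorem integral_exp_quadratic {β : ℝ} (hβ : 0 < β) (α : ℝ) :
    ∫ z : ℝ, Real.exp (-β * z ^ 2 + α * z) = √(Real.pi / β) * Real.exp (α ^ 2 / (4 * β)) := by
  have h : ∀ z : ℝ, Real.exp (-β * z ^ 2 + α * z) =
      Real.exp (α ^ 2 / (4 * β)) * Real.exp (-β * (z - α / (2 * β)) ^ 2) := by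
    intro z
    rw [← Real.exp_add]
    congr 1
    field_simp
    ring
  simp_rw [h]
  rw [integral_const_mul, integral_sub_right_eq_self (fun z => Real.exp (-β * z ^ 2)),
    integral_gaussian, mul_comm]

theorem lintegral_exp_quadratic_pi {d : ℕ} {β : ℝ} (hβ : 0 < β) (α : Fin d → ℝ) :
    ∫⁻ z : Fin d → ℝ, ENNReal.ofReal (Real.exp (-β * (z ⬝ᵥ z) + α ⬝ᵥ z)) =
      ENNReal.ofReal (√(Real.pi / β) ^ d * Real.exp ((α ⬝ᵥ α) / (4 * β))) := by
  have h : ∀ z : Fin d → ℝ, Real.exp (-β * (z ⬝ᵥ z) + α ⬝ᵥ z) =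
      ∏ i, Real.exp (-β * z i ^ 2 + α i * z i) := by
    intro z
    rw [← Real.exp_sum, Finset.sum_add_distrib, ← Finset.mul_sum]
    simp [dotProduct, sq]
  have hint : Integrable fun z : Fin d → ℝ => ∏ i, Real.exp (-β * z i ^ 2 + α i * z i) :=
    Integrable.fintype_prod_dep (f := fun i z => Real.exp (-β * z ^ 2 + α i * z))
      (μ := fun _ => volume) fun i => integrable_exp_quadratic hβ (α i)
  simp_rw [h]
  rw [← ofReal_integral_eq_lintegral_ofReal hint
    (ae_of_all _ fun _ => Finset.prod_nonneg fun _ _ => (Real.exp_pos _).le),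
    integral_fintype_prod_volume_eq_prod fun i z => Real.exp (-β * z ^ 2 + α i * z)]
  simp_rw [integral_exp_quadratic hβ]
  rw [Finset.prod_mul_distrib, Finset.prod_const, Finset.card_univ, Fintype.card_fin,
    ← Real.exp_sum, ← Finset.sum_div]
  simp [dotProduct, sq]

open scoped MatrixOrder in
-- Whitening: for a standard Gaussian z the direction Bᵀz has covariance H⁻¹, and its `H`-norm is
-- the Euclidean norm of z.
theorem PosDef.exists_inv_eq_transpose_mul {d : ℕ} {H : Matrix (Fin d) (Fin d) ℝ} (hH : H.PosDef) :
    ∃ B : Matrix (Fin d) (Fin d) ℝ, H⁻¹ = Bᵀ * B ∧ B * H * Bᵀ = 1 := by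
  obtain ⟨B, hB⟩ := CStarAlgebra.nonneg_iff_eq_star_mul_self.mp hH.inv.posSemidef.nonneg
  have hB' : H⁻¹ = Bᵀ * B := by
    rw [hB, Matrix.star_eq_conjTranspose, Matrix.conjTranspose_eq_transpose_of_trivial]
  refine ⟨B, hB', ?_⟩
  rw [mul_eq_one_comm, ← mul_assoc, ← hB',
    Matrix.nonsing_inv_mul _ ((Matrix.isUnit_iff_isUnit_det _).1 hH.isUnit)]

section

variable {d K : ℕ} (x : Fin K → EuclideanSpace ℝ (Fin d)) {lam : ℝ} (b : List (Fin K))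

theorem gram_mulVec (lam : ℝ) (u : Fin d → ℝ) :
    gram x lam b *ᵥ u =
      lam • u + ∑ s : Fin b.length, ((x (b.get s)).ofLp ⬝ᵥ u) • (x (b.get s)).ofLp := by
  rw [gram, Matrix.add_mulVec, Matrix.smul_mulVec, Matrix.one_mulVec]
  congr 1
  induction b with
  | nil => simp
  | cons i b ih =>
    rw [List.map_cons, List.sum_cons, Matrix.add_mulVec, ih]
    simp only [List.length_cons]
    rw [Fin.sum_univ_succ]
    congr 1
    rw [outer, Matrix.vecMulVec_mulVec]
    ext j
    simp [mul_comm]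

theorem sum_dotProduct_sq_le (hlam : 0 < lam) (u : Fin d → ℝ) :
    ∑ s : Fin b.length, (u ⬝ᵥ (x (b.get s)).ofLp) ^ 2 ≤ u ⬝ᵥ (gram x lam b *ᵥ u) := by
  rw [gram_mulVec, dotProduct_add, dotProduct_sum]
  have h : ∀ s : Fin b.length, u ⬝ᵥ (((x (b.get s)).ofLp ⬝ᵥ u) • (x (b.get s)).ofLp) =
      (u ⬝ᵥ (x (b.get s)).ofLp) ^ 2 := by
    intro s
    rw [dotProduct_smul, smul_eq_mul, dotProduct_comm _ u, sq]
  simp_rw [h]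
  refine le_add_of_nonneg_left ?_
  rw [dotProduct_smul, smul_eq_mul]
  exact mul_nonneg hlam.le (Finset.sum_nonneg fun i _ => mul_self_nonneg _)

/-- The sum of the noise-weighted arms of a batch. -/
def noiseSum (z : Fin b.length → ℝ) : Fin d → ℝ := ∑ s, z s • (x (b.get s)).ofLp

variable {Ω : Type*} [MeasurableSpace Ω] {μ : Measure Ω}

/-- The exponential moment of the self-normalized noise, by mixing over a Gaussian direction. -/
theorem lintegral_exp_noiseSum_le [IsProbabilityMeasure μ] (hlam : 0 < lam)
    {ξ : Fin b.length → Ω → ℝ}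
    (hind : iIndepFun ξ μ) (hsub : ∀ s, HasSubgaussianMGF (ξ s) 1 μ) :
    ∫⁻ ω, ENNReal.ofReal (Real.exp ((noiseSum x b fun s => ξ s ω) ⬝ᵥ
      ((gram x lam b)⁻¹ *ᵥ noiseSum x b fun s => ξ s ω) / 4)) ∂μ ≤ ENNReal.ofReal (√2 ^ d) := by
  have hH := gram_posDef x hlam b
  obtain ⟨B, hB1, hB2⟩ := PosDef.exists_inv_eq_transpose_mul hH
  let S : Ω → Fin d → ℝ := fun ω => noiseSum x b fun s => ξ s ω
  have hξ : ∀ s, AEMeasurable (ξ s) μ := fun s => (hsub s).aemeasurable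
  have hquad : ∀ ω, S ω ⬝ᵥ ((gram x lam b)⁻¹ *ᵥ S ω) = (B *ᵥ S ω) ⬝ᵥ (B *ᵥ S ω) := by
    intro ω
    rw [hB1, ← Matrix.mulVec_mulVec, Matrix.dotProduct_mulVec, Matrix.vecMul_transpose]
  -- The scale 1/√2 balances two averages of exp(α·z): over a standard Gaussian z it is
  -- exp(SᵀH⁻¹S/4), over the noise at most exp(|z|²/4), which leaves the integrable weight
  -- exp(-|z|²/4).
  let α : Ω → Fin d → ℝ := fun ω => (√2)⁻¹ • (B *ᵥ S ω)
  have h22 : (√2)⁻¹ * (√2)⁻¹ = (1 / 2 : ℝ) := by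
    rw [← mul_inv, Real.mul_self_sqrt (by norm_num)]; norm_num
  have hαα : ∀ ω, α ω ⬝ᵥ α ω = S ω ⬝ᵥ ((gram x lam b)⁻¹ *ᵥ S ω) / 2 := by
    intro ω
    simp only [α, smul_dotProduct, dotProduct_smul, smul_eq_mul]
    rw [← mul_assoc, h22, hquad]
    ring
  have hαz : ∀ ω z, α ω ⬝ᵥ z =
      ∑ s, ((√2)⁻¹ * ((Bᵀ *ᵥ z) ⬝ᵥ (x (b.get s)).ofLp)) * ξ s ω := by
    intro ω z
    simp only [α, S, noiseSum, smul_dotProduct, smul_eq_mul]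
    rw [dotProduct_comm, Matrix.dotProduct_mulVec, ← Matrix.mulVec_transpose, dotProduct_sum,
      Finset.mul_sum]
    refine Finset.sum_congr rfl fun s _ => ?_
    rw [dotProduct_smul, smul_eq_mul]
    ring
  have hsq : ∀ z : Fin d → ℝ,
      ∑ s, ((√2)⁻¹ * ((Bᵀ *ᵥ z) ⬝ᵥ (x (b.get s)).ofLp)) ^ 2 ≤ (z ⬝ᵥ z) / 2 := by
    intro z
    have h1 := sum_dotProduct_sq_le x b hlam (Bᵀ *ᵥ z)
    have h2 : (Bᵀ *ᵥ z) ⬝ᵥ (gram x lam b *ᵥ (Bᵀ *ᵥ z)) = z ⬝ᵥ z := by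
      rw [Matrix.mulVec_transpose, ← Matrix.dotProduct_mulVec, ← Matrix.mulVec_transpose,
        Matrix.mulVec_mulVec, Matrix.mulVec_mulVec, hB2, Matrix.one_mulVec]
    simp_rw [mul_pow, ← Finset.mul_sum]
    rw [sq (√2)⁻¹, h22]
    linarith
  have hZ : 0 < √(2 * Real.pi) ^ d := by have := Real.pi_pos; positivity
  have hmeas : AEMeasurable (Function.uncurry fun ω (z : Fin d → ℝ) =>
      ENNReal.ofReal (Real.exp (-(1 / 2) * (z ⬝ᵥ z) + α ω ⬝ᵥ z))) (μ.prod volume) := by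
    have h1 : ∀ s, AEMeasurable (fun p : Ω × (Fin d → ℝ) => ξ s p.1) (μ.prod volume) :=
      fun s => (hξ s).comp_quasiMeasurePreserving Measure.quasiMeasurePreserving_fst
    refine (Real.measurable_exp.comp_aemeasurable (AEMeasurable.add ?_ ?_)).ennreal_ofReal
    · refine Measurable.aemeasurable ?_
      simp only [dotProduct]
      fun_prop
    · simp_rw [hαz]
      refine Finset.aemeasurable_fun_sum _ fun s _ => AEMeasurable.mul ?_ (h1 s)
      refine Measurable.aemeasurable ?_
      have : Continuous fun z : Fin d → ℝ => (√2)⁻¹ * ((Bᵀ *ᵥ z) ⬝ᵥ (x (b.get s)).ofLp) := by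
        fun_prop
      exact this.measurable.comp measurable_snd
  have h1 : ∀ ω, ENNReal.ofReal (√(2 * Real.pi) ^ d) *
      ENNReal.ofReal (Real.exp (S ω ⬝ᵥ ((gram x lam b)⁻¹ *ᵥ S ω) / 4)) =
      ∫⁻ z : Fin d → ℝ, ENNReal.ofReal (Real.exp (-(1 / 2) * (z ⬝ᵥ z) + α ω ⬝ᵥ z)) := by
    intro ω
    have e1 : Real.pi / (1 / 2) = 2 * Real.pi := by ring
    have e2 : S ω ⬝ᵥ ((gram x lam b)⁻¹ *ᵥ S ω) / 2 / (4 * (1 / 2)) =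
        S ω ⬝ᵥ ((gram x lam b)⁻¹ *ᵥ S ω) / 4 := by ring
    rw [lintegral_exp_quadratic_pi (by norm_num), hαα, ← ENNReal.ofReal_mul hZ.le, e1, e2]
  have h2 : ENNReal.ofReal (√(2 * Real.pi) ^ d) *
      ∫⁻ ω, ENNReal.ofReal (Real.exp (S ω ⬝ᵥ ((gram x lam b)⁻¹ *ᵥ S ω) / 4)) ∂μ ≤
      ENNReal.ofReal (√(2 * Real.pi) ^ d) * ENNReal.ofReal (√2 ^ d) := by
    rw [← lintegral_const_mul' _ _ ENNReal.ofReal_ne_top]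
    simp_rw [h1]
    -- After Tonelli the z-integral is (4π)^{d/2}; division by the normalization (2π)^{d/2} leaves
    -- √2^d.
    rw [lintegral_lintegral_swap hmeas]
    calc _ ≤ ∫⁻ z : Fin d → ℝ,
          ENNReal.ofReal (Real.exp (-(1 / 4) * (z ⬝ᵥ z) + (0 : Fin d → ℝ) ⬝ᵥ z)) := by
          refine lintegral_mono fun z => ?_
          have h3 := lintegral_exp_linear_le hind hsub _ (hsq z)
          simp_rw [← hαz] at h3
          simp_rw [Real.exp_add, ENNReal.ofReal_mul (Real.exp_pos _).le]
          rw [lintegral_const_mul' _ _ ENNReal.ofReal_ne_top]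
          refine (mul_le_mul_right h3 _).trans_eq ?_
          rw [← ENNReal.ofReal_mul (Real.exp_pos _).le, ← ENNReal.ofReal_mul (Real.exp_pos _).le,
            ← Real.exp_add, ← Real.exp_add, zero_dotProduct]
          congr 2
          ring
      _ = _ := by
          rw [lintegral_exp_quadratic_pi (by norm_num), ← ENNReal.ofReal_mul hZ.le, ← mul_pow,
            ← Real.sqrt_mul (by have := Real.pi_pos; positivity)]
          simp only [zero_dotProduct, zero_div, Real.exp_zero, mul_one]
          congr 3
          ring
  rwa [ENNReal.mul_le_mul_iff_right (ENNReal.ofReal_pos.2 hZ).ne' ENNReal.ofReal_ne_top] at h2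

end

/-! ### The estimation error and its two confidence radii -/

section

variable {d K : ℕ} (x : Fin K → EuclideanSpace ℝ (Fin d)) {lam : ℝ} (b : List (Fin K))

/-- The error of the regularized least squares estimator when `z` is the noise of the batch. -/
noncomputable def noiseError (lam : ℝ) (θ : EuclideanSpace ℝ (Fin d)) (z : Fin b.length → ℝ) : Fin d → ℝ :=
  (gram x lam b)⁻¹ *ᵥ noiseSum x b z - lam • ((gram x lam b)⁻¹ *ᵥ θ.ofLp)

/-- The reward-weighted sum of arms is (H - λI)θ plus the noise sum; apply H⁻¹. -/
theorem estimator_ofLp_eq (hlam : 0 < lam) (θ : EuclideanSpace ℝ (Fin d)) (t : ℕ) (r : ℕ → ℝ)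
    (z : Fin b.length → ℝ)
    (hr : ∀ s : Fin b.length, r (t + s) = inner ℝ (x (b.get s)) θ + z s) :
    (estimator x lam b t r).ofLp = θ.ofLp + noiseError x b lam θ z := by
  have hH := gram_posDef x hlam b
  have h1 : (∑ s : Fin b.length, r (t + s) • x (b.get s)).ofLp =
      gram x lam b *ᵥ θ.ofLp - lam • θ.ofLp + noiseSum x b z := by
    rw [gram_mulVec, add_sub_cancel_left, noiseSum, ← Finset.sum_add_distrib, WithLp.ofLp_sum]
    refine Finset.sum_congr rfl fun s _ => ?_
    rw [hr, inner_eq_dotProduct, WithLp.ofLp_smul, add_smul]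
  rw [estimator, h1, Matrix.mulVec_add, Matrix.mulVec_sub, PosDef.inv_mulVec_mulVec hH,
    Matrix.mulVec_smul, noiseError, sub_add_eq_add_sub, add_sub_assoc]

theorem dotProduct_inv_noiseSum (hlam : 0 < lam) (v : Fin d → ℝ) (z : Fin b.length → ℝ) :
    v ⬝ᵥ ((gram x lam b)⁻¹ *ᵥ noiseSum x b z) =
      ∑ s, (((gram x lam b)⁻¹ *ᵥ v) ⬝ᵥ (x (b.get s)).ofLp) * z s := by
  rw [IsHermitian.bilin_comm (gram_posDef x hlam b).inv.isHermitian, dotProduct_comm, noiseSum,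
    dotProduct_sum]
  refine Finset.sum_congr rfl fun s _ => ?_
  rw [dotProduct_smul, smul_eq_mul, mul_comm]

/-- Bounds the variance proxy of the linear combination in `dotProduct_inv_noiseSum`, as the sum of
the x xᵀ is at most H. -/
theorem sum_inv_dotProduct_sq_le (hlam : 0 < lam) (v : EuclideanSpace ℝ (Fin d)) :
    ∑ s : Fin b.length, (((gram x lam b)⁻¹ *ᵥ v.ofLp) ⬝ᵥ (x (b.get s)).ofLp) ^ 2 ≤
      wnorm (gram x lam b)⁻¹ v ^ 2 := by
  have hH := gram_posDef x hlam b
  refine (sum_dotProduct_sq_le x b hlam _).trans_eq ?_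
  rw [PosDef.mulVec_inv_mulVec hH, dotProduct_comm, wnorm_sq hH.inv.posSemidef]

theorem dotProduct_noiseError_le (hlam : 0 < lam) {θ : EuclideanSpace ℝ (Fin d)} (hθ : ‖θ‖ ≤ 1)
    (v : EuclideanSpace ℝ (Fin d)) (z : Fin b.length → ℝ) :
    v.ofLp ⬝ᵥ noiseError x b lam θ z ≤
      v.ofLp ⬝ᵥ ((gram x lam b)⁻¹ *ᵥ noiseSum x b z) + √lam * wnorm (gram x lam b)⁻¹ v := by
  have h := neg_le_of_abs_le (bias_le x hlam b v θ hθ)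
  rw [noiseError, dotProduct_sub, dotProduct_smul, smul_eq_mul]
  linarith

variable {Ω : Type*} [MeasurableSpace Ω] {μ : Measure Ω} [IsProbabilityMeasure μ]
  {ξ : Fin b.length → Ω → ℝ}

theorem measure_direction_le (hlam : 0 < lam) (hind : iIndepFun ξ μ)
    (hsub : ∀ s, HasSubgaussianMGF (ξ s) 1 μ) {θ : EuclideanSpace ℝ (Fin d)} (hθ : ‖θ‖ ≤ 1)
    (v : EuclideanSpace ℝ (Fin d)) {ρ : ℝ} (hρ : 0 ≤ ρ) :
    μ {ω | wnorm (gram x lam b)⁻¹ v * (ρ + √lam) <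
      v.ofLp ⬝ᵥ noiseError x b lam θ fun s => ξ s ω} ≤
      ENNReal.ofReal (Real.exp (-ρ ^ 2 / 2)) := by
  have hsq := sum_inv_dotProduct_sq_le x b hlam v
  have hsubset : ∀ ω, wnorm (gram x lam b)⁻¹ v * (ρ + √lam) <
      v.ofLp ⬝ᵥ noiseError x b lam θ (fun s => ξ s ω) → wnorm (gram x lam b)⁻¹ v * ρ <
        ∑ s, (((gram x lam b)⁻¹ *ᵥ v.ofLp) ⬝ᵥ (x (b.get s)).ofLp) * ξ s ω := by
    intro ω hω
    have h := dotProduct_noiseError_le x b hlam hθ v fun s => ξ s ω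
    rw [dotProduct_inv_noiseSum x b hlam] at h
    linarith
  -- Chernoff's bound is stated for σ > 0. If σ = 0, all coefficients vanish and the strict
  -- inequality cannot hold.
  rcases (wnorm_nonneg (gram x lam b)⁻¹ v).eq_or_lt with h0 | h0
  · refine le_of_eq_of_le ?_ zero_le
    convert measure_empty (μ := μ)
    refine Set.eq_empty_of_forall_notMem fun ω hω => ?_
    have h1 := hsubset ω hω
    rw [← h0, sq, mul_zero] at hsq
    have h2 := (Finset.sum_eq_zero_iff_of_nonneg fun s _ => sq_nonneg _).1
      (hsq.antisymm (Finset.sum_nonneg fun s _ => sq_nonneg _))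
    rw [← h0, zero_mul, Finset.sum_eq_zero] at h1
    · exact lt_irrefl _ h1
    · intro s hs
      rw [pow_eq_zero_iff two_ne_zero |>.1 (h2 s hs), zero_mul]
  · exact (measure_mono fun ω hω => (hsubset ω hω).le).trans
      (measure_linear_gt_le hind hsub _ h0 hρ hsq)

/-- By Cauchy-Schwarz the noise in direction v is at most ‖v‖ √q with q = SᵀH⁻¹S, so a violation in
any direction forces exp(q/4) ≥ X; Markov's inequality with the Gaussian mixture moment finishes. -/
theorem measure_radiusLarge_le (hd : 2 ≤ d) {T : ℕ} (hT : 3 ≤ T) (hlam : 0 < lam)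
    (hind : iIndepFun ξ μ)
    (hsub : ∀ s, HasSubgaussianMGF (ξ s) 1 μ) {θ : EuclideanSpace ℝ (Fin d)} (hθ : ‖θ‖ ≤ 1) :
    μ {ω | ∃ v : EuclideanSpace ℝ (Fin d),
      wnorm (gram x lam b)⁻¹ v * radiusLarge d T lam (1 / T) <
        v.ofLp ⬝ᵥ noiseError x b lam θ fun s => ξ s ω} ≤
      ENNReal.ofReal (1 / T / batchBound T) := by
  have hd' : (2 : ℝ) ≤ d := by exact_mod_cast hd
  have hT' : (3 : ℝ) ≤ T := by exact_mod_cast hT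
  have hb : (2 : ℝ) ≤ batchBound T := by exact_mod_cast two_le_batchBound hT
  have hH := gram_posDef x hlam b
  have hpi := Real.pi_gt_three
  let q : (Fin b.length → ℝ) → ℝ := fun z =>
    noiseSum x b z ⬝ᵥ ((gram x lam b)⁻¹ *ᵥ noiseSum x b z)
  have hq : Continuous q := by
    simp only [q, noiseSum]
    fun_prop
  set X := 8 * Real.pi * d * (batchBound T : ℝ) ^ 2 / ((15 / 64 : ℝ) ^ (d - 1) * (1 / T) ^ 2)
    with hX
  have hX0 : 0 < X := by positivity
  have hsubset : {ω | ∃ v : EuclideanSpace ℝ (Fin d),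
      wnorm (gram x lam b)⁻¹ v * radiusLarge d T lam (1 / T) <
        v.ofLp ⬝ᵥ noiseError x b lam θ fun s => ξ s ω} ⊆
      {ω | ENNReal.ofReal X ≤ ENNReal.ofReal (Real.exp (q (fun s => ξ s ω) / 4))} := by
    rintro ω ⟨v, hv⟩
    have h1 := dotProduct_noiseError_le x b hlam hθ v fun s => ξ s ω
    have h2 := PosSemidef.bilin_sq_le hH.inv.posSemidef v.ofLp (noiseSum x b fun s => ξ s ω)
    rw [← wnorm_sq hH.inv.posSemidef v] at h2
    have hq0 : 0 ≤ q fun s => ξ s ω := PosSemidef.quad_nonneg hH.inv.posSemidef _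
    have h3 : v.ofLp ⬝ᵥ ((gram x lam b)⁻¹ *ᵥ noiseSum x b fun s => ξ s ω) ≤
        wnorm (gram x lam b)⁻¹ v * √(q fun s => ξ s ω) := by
      refine le_of_abs_le (abs_le_of_sq_le_sq ?_
        (mul_nonneg (wnorm_nonneg _ _) (Real.sqrt_nonneg _)))
      rw [mul_pow, Real.sq_sqrt hq0]
      exact h2
    have h0 := wnorm_nonneg (gram x lam b)⁻¹ v
    rw [radiusLarge, ← hX] at hv
    have h4 : wnorm (gram x lam b)⁻¹ v * (2 * √(Real.log X)) <
        wnorm (gram x lam b)⁻¹ v * √(q fun s => ξ s ω) := by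
      have := mul_nonneg h0 (Real.sqrt_nonneg lam)
      linarith
    have h5 := lt_of_mul_lt_mul_left h4 h0
    have h6 : Real.log X ≤ q (fun s => ξ s ω) / 4 := by
      rw [Real.lt_sqrt (by positivity), mul_pow] at h5
      rcases le_total (Real.log X) 0 with h | h
      · exact h.trans (by positivity)
      · rw [Real.sq_sqrt h] at h5
        linarith
    exact ENNReal.ofReal_le_ofReal ((Real.log_le_iff_le_exp hX0).1 h6)
  have hmeas : AEMeasurable (fun ω =>
      ENNReal.ofReal (Real.exp (q (fun s => ξ s ω) / 4))) μ :=
    (Real.measurable_exp.comp_aemeasurable ((hq.measurable.comp_aemeasurable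
      (aemeasurable_pi_lambda _ fun s => (hsub s).aemeasurable)).div_const 4)).ennreal_ofReal
  have hX1 : √2 ^ d / X ≤ 1 / T / batchBound T := by
    have h1 : X = 8 * Real.pi * d * (64 / 15) ^ (d - 1) * ((batchBound T : ℝ) ^ 2 * T ^ 2) := by
      have : (64 / 15 : ℝ) ^ (d - 1) = ((15 / 64 : ℝ) ^ (d - 1))⁻¹ := by
        rw [← inv_pow]; norm_num
      rw [hX, this]
      field_simp
    -- For d ≥ 2 one has d ≤ 2(d - 1), hence √2^d ≤ 2^d ≤ 4^{d-1}, and 4 < 64/15.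
    have h2 : √2 ^ d ≤ (64 / 15 : ℝ) ^ (d - 1) := by
      have h3 : √2 ≤ 2 := by rw [Real.sqrt_le_left (by norm_num)]; norm_num
      calc √2 ^ d ≤ (2 : ℝ) ^ d := by gcongr
        _ ≤ 2 ^ (2 * (d - 1)) := pow_le_pow_right₀ one_le_two (by omega)
        _ = 4 ^ (d - 1) := by rw [pow_mul]; norm_num
        _ ≤ _ := by gcongr; norm_num
    rw [div_div, div_le_div_iff₀ hX0 (by positivity), one_mul, h1]
    have h4 : (T : ℝ) * batchBound T ≤ (batchBound T : ℝ) ^ 2 * T ^ 2 := by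
      have : 1 ≤ (T : ℝ) * batchBound T := by nlinarith
      nlinarith
    have h5 : 1 ≤ 8 * Real.pi * d := by nlinarith
    calc √2 ^ d * ((T : ℝ) * batchBound T)
        ≤ (64 / 15 : ℝ) ^ (d - 1) * ((batchBound T : ℝ) ^ 2 * T ^ 2) := by gcongr
      _ ≤ 8 * Real.pi * d * ((64 / 15 : ℝ) ^ (d - 1) * ((batchBound T : ℝ) ^ 2 * T ^ 2)) :=
        le_mul_of_one_le_left (by positivity) h5
      _ = _ := by ring
  calc _ ≤ μ {ω | ENNReal.ofReal X ≤ ENNReal.ofReal (Real.exp (q (fun s => ξ s ω) / 4))} :=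
        measure_mono hsubset
    _ ≤ (∫⁻ ω, ENNReal.ofReal (Real.exp (q (fun s => ξ s ω) / 4)) ∂μ) / ENNReal.ofReal X :=
        meas_ge_le_lintegral_div hmeas (ENNReal.ofReal_pos.2 hX0).ne' ENNReal.ofReal_ne_top
    _ ≤ ENNReal.ofReal (√2 ^ d) / ENNReal.ofReal X :=
        ENNReal.div_le_div_right (lintegral_exp_noiseSum_le x b hlam hind hsub) _
    _ ≤ _ := by
        rw [← ENNReal.ofReal_div_of_pos hX0]
        exact ENNReal.ofReal_le_ofReal hX1

/-- The noise for which the estimate of the difference of some two arms in `A` is too large. -/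
def badNoise (T : ℕ) (lam : ℝ) (θ : EuclideanSpace ℝ (Fin d)) (A : Finset (Fin K)) :
    Set (Fin b.length → ℝ) :=
  {z | ∃ i ∈ A, ∃ j ∈ A, wnorm (gram x lam b)⁻¹ (x i - x j) *
    min (radiusLarge d T lam (1 / T)) (radiusSmall A.card T lam (1 / T)) <
      (x i - x j).ofLp ⬝ᵥ noiseError x b lam θ z}

theorem measurableSet_badNoise (T : ℕ) (lam : ℝ) (θ : EuclideanSpace ℝ (Fin d))
    (A : Finset (Fin K)) : MeasurableSet (badNoise x b T lam θ A) := by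
  have h : badNoise x b T lam θ A = ⋃ i ∈ A, ⋃ j ∈ A, {z | wnorm (gram x lam b)⁻¹ (x i - x j) *
      min (radiusLarge d T lam (1 / T)) (radiusSmall A.card T lam (1 / T)) <
        (x i - x j).ofLp ⬝ᵥ noiseError x b lam θ z} := by
    ext z
    simp [badNoise]
  rw [h]
  refine A.measurableSet_biUnion fun i _ => A.measurableSet_biUnion fun j _ =>
    measurableSet_lt measurable_const (Continuous.measurable ?_)
  unfold noiseError noiseSum
  fun_prop

/-- A union bound over the n² - n ordered pairs of distinct arms, each failing with probability at
most 1/(bT(n² - n)). -/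
theorem measure_radiusSmall_le {T : ℕ} (hT : 3 ≤ T) (hlam : 0 < lam)
    (hind : iIndepFun ξ μ)
    (hsub : ∀ s, HasSubgaussianMGF (ξ s) 1 μ) {θ : EuclideanSpace ℝ (Fin d)} (hθ : ‖θ‖ ≤ 1)
    (A : Finset (Fin K)) :
    μ {ω | ∃ i ∈ A, ∃ j ∈ A,
      wnorm (gram x lam b)⁻¹ (x i - x j) * radiusSmall A.card T lam (1 / T) <
        (x i - x j).ofLp ⬝ᵥ noiseError x b lam θ fun s => ξ s ω} ≤
      ENNReal.ofReal (1 / T / batchBound T) := by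
  classical
  have hT' : (3 : ℝ) ≤ T := by exact_mod_cast hT
  have hb : (2 : ℝ) ≤ batchBound T := by exact_mod_cast two_le_batchBound hT
  set Y := ((A.card : ℝ) ^ 2 - A.card) / (1 / T / (batchBound T : ℝ)) with hY
  have hcard : (A.offDiag.card : ℝ) = (A.card : ℝ) ^ 2 - A.card := by
    rw [Finset.offDiag_card, Nat.cast_sub (Nat.le_mul_self _)]
    push_cast
    ring
  have hsubset : {ω | ∃ i ∈ A, ∃ j ∈ A,
      wnorm (gram x lam b)⁻¹ (x i - x j) * radiusSmall A.card T lam (1 / T) <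
        (x i - x j).ofLp ⬝ᵥ noiseError x b lam θ fun s => ξ s ω} ⊆
      ⋃ p ∈ A.offDiag, {ω | wnorm (gram x lam b)⁻¹ (x p.1 - x p.2) *
        (√(2 * Real.log Y) + √lam) <
          (x p.1 - x p.2).ofLp ⬝ᵥ noiseError x b lam θ fun s => ξ s ω} := by
    rintro ω ⟨i, hi, j, hj, hij⟩
    have hne : i ≠ j := by
      rintro rfl
      simp [wnorm] at hij
    simp only [Set.mem_iUnion]
    exact ⟨(i, j), Finset.mem_offDiag.2 ⟨hi, hj, hne⟩, hij⟩
  refine (measure_mono hsubset).trans ((measure_biUnion_finset_le _ _).trans ?_)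
  rcases Nat.eq_zero_or_pos A.offDiag.card with h0 | h0
  · rw [Finset.card_eq_zero.1 h0]
    simp
  · have h1 : (1 : ℝ) ≤ (A.card : ℝ) ^ 2 - A.card := by
      rw [← hcard]; exact_mod_cast h0
    have hY1 : 1 ≤ Y := by
      have : 1 / T / (batchBound T : ℝ) ≤ 1 := by
        rw [div_div, div_le_one (by positivity)]
        nlinarith
      rw [hY, one_le_div (by positivity)]
      linarith
    have hexp : Real.exp (-√(2 * Real.log Y) ^ 2 / 2) = Y⁻¹ := by
      have := Real.log_nonneg hY1
      rw [Real.sq_sqrt (by positivity), neg_div, mul_div_cancel_left₀ _ two_ne_zero, Real.exp_neg,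
        Real.exp_log (by linarith)]
    refine (Finset.sum_le_card_nsmul _ _ _ fun p _ => measure_direction_le x b hlam hind hsub hθ
      (x p.1 - x p.2) (Real.sqrt_nonneg (2 * Real.log Y))).trans ?_
    rw [hexp, nsmul_eq_mul, ← ENNReal.ofReal_natCast, ← ENNReal.ofReal_mul (by positivity), hcard,
      hY]
    refine ENNReal.ofReal_le_ofReal (le_of_eq ?_)
    generalize (A.card : ℝ) ^ 2 - A.card = m at h1
    have : m ≠ 0 := by linarith
    field_simp

/-- For fixed `A` the minimum is one of the two radii, and which one is not random, so no
probability is lost in combining them. -/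
theorem measure_badNoise_le (hd : 2 ≤ d) {T : ℕ} (hT : 3 ≤ T) (hlam : 0 < lam)
    (hind : iIndepFun ξ μ)
    (hsub : ∀ s, HasSubgaussianMGF (ξ s) 1 μ) {θ : EuclideanSpace ℝ (Fin d)} (hθ : ‖θ‖ ≤ 1)
    (A : Finset (Fin K)) :
    μ {ω | (fun s => ξ s ω) ∈ badNoise x b T lam θ A} ≤
      ENNReal.ofReal (1 / T / batchBound T) := by
  rcases min_choice (radiusLarge d T lam (1 / T)) (radiusSmall A.card T lam (1 / T)) with h | h
  · refine (measure_mono ?_).trans (measure_radiusLarge_le x b hd hT hlam hind hsub hθ)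
    rintro ω ⟨i, _, j, _, hij⟩
    rw [h] at hij
    exact ⟨x i - x j, hij⟩
  · refine (measure_mono ?_).trans (measure_radiusSmall_le x b hT hlam hind hsub hθ A)
    rintro ω ⟨i, hi, j, hj, hij⟩
    rw [h] at hij
    exact ⟨i, hi, j, hj, hij⟩

end

/-! ### Failure of a batch, conditionally on the history -/

section

variable {d K : ℕ} {x : Fin K → EuclideanSpace ℝ (Fin d)} {T : ℕ} {lam : ℝ} {P : Policy K}

/-- The estimate of the difference of some two remaining arms in batch `ℓ + 1` is off by more than
the confidence radius. -/
def IsBadBatch (x : Fin K → EuclideanSpace ℝ (Fin d)) (T : ℕ) (lam : ℝ) (P : Policy K)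
    (θ : EuclideanSpace ℝ (Fin d)) (r : ℕ → ℝ) (ℓ : ℕ) : Prop :=
  (fun s : Fin (P.pulls T r ℓ).length => r (P.elapsed T r ℓ + s) -
    inner ℝ (x ((P.pulls T r ℓ).get s)) θ) ∈
      badNoise x (P.pulls T r ℓ) T lam θ (P.arms T r ℓ).toFinset

theorem reward_eq_of_prefix {Ω : Type*} {θ : EuclideanSpace ℝ (Fin d)} {η r : ℕ → Ω → ℝ}
    (hr : ∀ ω t i, (P.allPlayed T (fun s => r s ω))[t]? = some i →
      r t ω = inner ℝ (x i) θ + η t ω) {ℓ : ℕ} (hℓ : ℓ ≤ T) {ω : Ω} {s : ℕ} {i : Fin K}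
    (h : (P.played T (fun s => r s ω) ℓ)[s]? = some i) :
    r s ω = inner ℝ (x i) θ + η s ω :=
  hr ω s i (getElem?_of_isPrefix (P.played_prefix T _ hℓ) h)

/-- The decisions in a batch are a function of the noise in the earlier batches. -/
theorem IsBLAE.exists_measurableSet_noise {Ω : Type*} {θ : EuclideanSpace ℝ (Fin d)}
    {η r : ℕ → Ω → ℝ} (h : IsBLAE x T lam P)
    (hr : ∀ ω t i, (P.allPlayed T (fun s => r s ω))[t]? = some i →
      r t ω = inner ℝ (x i) θ + η t ω) {ℓ : ℕ} (hℓ : ℓ ≤ T) (L A b : List (Fin K)) :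
    ∃ D : Set (Fin L.length → ℝ), MeasurableSet D ∧
      ∀ ω, (P.played T (fun s => r s ω) ℓ = L ∧ P.arms T (fun s => r s ω) ℓ = A ∧
        P.pulls T (fun s => r s ω) ℓ = b) ↔ (fun s : Fin L.length => η s ω) ∈ D := by
  obtain ⟨D, hD, hDr⟩ := h.exists_measurableSet_state ℓ L A b
  refine ⟨(fun (z : Fin L.length → ℝ) s => inner ℝ (x (L.get s)) θ + z s) ⁻¹' D,
    (by fun_prop : Measurable fun (z : Fin L.length → ℝ) (s : Fin L.length) =>
      inner ℝ (x (L.get s)) θ + z s) hD, fun ω => ?_⟩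
  rw [Set.mem_preimage]
  have key : P.played T (fun s => r s ω) ℓ = L → (fun s : Fin L.length => r s ω) =
      fun s => inner ℝ (x (L.get s)) θ + η s ω := by
    intro hL
    funext s
    refine reward_eq_of_prefix hr hℓ (ω := ω) ?_
    rw [hL]
    exact List.getElem?_eq_getElem s.2
  constructor
  · intro hω
    rw [← key hω.1]
    exact (hDr fun s => r s ω).1 hω
  · intro hω
    -- The rewards that this noise would produce along `L`. Membership in `D` says that `L` is
    -- played under `r'`; since `r` obeys the same reward rule, `L` is played under `r` as well.
    let r' : ℕ → ℝ := fun s =>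
      if hs : s < L.length then inner ℝ (x (L.get ⟨s, hs⟩)) θ + η s ω else r s ω
    have h1 : (fun s : Fin L.length => r' s) =
        fun s => inner ℝ (x (L.get s)) θ + η s ω := by
      funext s
      simp [r']
    have h2 := (hDr r').2 (h1 ▸ hω)
    have h3 : P.played T (fun s => r s ω) ℓ = L := by
      refine played_eq_iff_of_rewards (r' := r') (f := fun i s => inner ℝ (x i) θ + η s ω)
        (fun s i hs => reward_eq_of_prefix hr hℓ hs) (fun s i hs => ?_) h2.1
      obtain ⟨hs', rfl⟩ := List.getElem?_eq_some_iff.1 hs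
      simp [r', hs']
    exact (hDr fun s => r s ω).2 (by rw [key h3]; exact hω)

variable {Ω : Type*} [MeasurableSpace Ω] {μ : Measure Ω} [IsProbabilityMeasure μ]
  {θ : EuclideanSpace ℝ (Fin d)} {η r : ℕ → Ω → ℝ}

/-- There are countably many states (arms played, remaining arms, next batch). Each is an event of
the noise so far, hence independent of the noise in the next batch, which is bad with probability at
most 1/(bT); sum over the states. -/
theorem IsBLAE.measure_isBadBatch_le (h : IsBLAE x T lam P) (hd : 2 ≤ d)
    (hT : 3 ≤ T) (hlam : 0 < lam) (hθ : ‖θ‖ ≤ 1) (hind : iIndepFun (fun t : Fin T => η t) μ)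
    (hsub : ∀ t < T, HasSubgaussianMGF (η t) 1 μ) (hmeas : ∀ t, Measurable (r t))
    (hr : ∀ ω t i, (P.allPlayed T (fun s => r s ω))[t]? = some i →
      r t ω = inner ℝ (x i) θ + η t ω) {ℓ : ℕ} (hℓ : ℓ < T) :
    μ {ω | IsBadBatch x T lam P θ (fun s => r s ω) ℓ} ≤
      ENNReal.ofReal (1 / T / batchBound T) := by
  let state : Ω → List (Fin K) × List (Fin K) × List (Fin K) := fun ω =>
    (P.played T (fun s => r s ω) ℓ, P.arms T (fun s => r s ω) ℓ, P.pulls T (fun s => r s ω) ℓ)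
  have hstate : ∀ q, MeasurableSet {ω | state ω = q} := by
    rintro ⟨L, A, b⟩
    obtain ⟨D, hD, hDr⟩ := h.exists_measurableSet_state ℓ L A b
    have h1 : {ω | state ω = (L, A, b)} = (fun ω (s : Fin L.length) => r s ω) ⁻¹' D := by
      ext ω
      rw [Set.mem_preimage, ← hDr fun s => r s ω]
      simp [state]
    rw [h1]
    exact (measurable_pi_lambda (fun ω (s : Fin L.length) => r s ω) fun s => hmeas s) hD
  let bad : List (Fin K) × List (Fin K) × List (Fin K) → Set Ω := fun q =>
    {ω | (fun s : Fin q.2.2.length => η (q.1.length + s) ω) ∈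
      badNoise x q.2.2 T lam θ q.2.1.toFinset}
  have hsubset : {ω | IsBadBatch x T lam P θ (fun s => r s ω) ℓ} ⊆
      ⋃ q, {ω | state ω = q} ∩ bad q := by
    intro ω hω
    refine Set.mem_iUnion.2 ⟨state ω, rfl, ?_⟩
    have heq : (fun s : Fin (P.pulls T (fun s => r s ω) ℓ).length =>
        η ((P.played T (fun s => r s ω) ℓ).length + s) ω) =
        fun s : Fin (P.pulls T (fun s => r s ω) ℓ).length =>
          r (P.elapsed T (fun s => r s ω) ℓ + s) ω -
          inner ℝ (x ((P.pulls T (fun s => r s ω) ℓ).get s)) θ := by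
      funext s
      rw [reward_eq_of_prefix hr (ℓ := ℓ + 1) (by omega) (ω := ω)
        (s := P.elapsed T (fun s => r s ω) ℓ + (s : ℕ))
        (i := (P.pulls T (fun s => r s ω) ℓ).get s)]
      · rw [Policy.elapsed]; ring
      · rw [Policy.played_succ, Policy.elapsed, List.getElem?_append_right (by omega),
          Nat.add_sub_cancel_left]
        exact List.getElem?_eq_getElem s.2
    change (fun s : Fin (P.pulls T (fun s => r s ω) ℓ).length =>
      η ((P.played T (fun s => r s ω) ℓ).length + s) ω) ∈ badNoise x _ T lam θ _
    rw [heq]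
    exact hω
  have hprod : ∀ q, μ ({ω | state ω = q} ∩ bad q) ≤
      μ {ω | state ω = q} * ENNReal.ofReal (1 / T / batchBound T) := by
    rintro ⟨L, A, b⟩
    -- A state that occurs satisfies |L| + |b| ≤ T, which keeps both stretches of noise inside `Fin
    -- T`.
    rcases Set.eq_empty_or_nonempty {ω | state ω = (L, A, b)} with h0 | ⟨ω₀, hω₀⟩
    · rw [h0]; simp
    have hlen : L.length + b.length ≤ T := by
      have h1 := P.elapsed_le T (fun s => r s ω₀) (ℓ + 1)
      rw [P.elapsed_succ, Policy.elapsed] at h1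
      simp only [state, Set.mem_ofPred_eq, Prod.mk.injEq] at hω₀
      rwa [hω₀.1, hω₀.2.2] at h1
    obtain ⟨D, hD, hDr⟩ := h.exists_measurableSet_noise hr hℓ.le L A b
    have h1 : {ω | state ω = (L, A, b)} = (fun ω (s : Fin L.length) => η s ω) ⁻¹' D := by
      ext ω
      rw [Set.mem_preimage, ← hDr ω]
      simp [state]
    have hindep : IndepFun (fun ω (s : Fin L.length) => η s ω)
        (fun ω (s : Fin b.length) => η (L.length + s) ω) μ := by
      have h2 := hind.indepFun_finset₀ (Finset.univ.filter fun t : Fin T => (t : ℕ) < L.length)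
        (Finset.univ.filter fun t : Fin T => ¬ (t : ℕ) < L.length)
        (Finset.disjoint_filter_filter_not _ _ _) fun t => (hsub t t.2).aemeasurable
      refine h2.comp
        (φ := fun z (s : Fin L.length) => z ⟨⟨s, by omega⟩, by simp⟩)
        (ψ := fun z (s : Fin b.length) => z ⟨⟨L.length + s, by omega⟩, by simp⟩) ?_ ?_ <;>
      fun_prop
    have hbad : bad (L, A, b) = (fun ω (s : Fin b.length) => η (L.length + s) ω) ⁻¹'
        badNoise x b T lam θ A.toFinset := rfl
    rw [hbad, h1, hindep.measure_inter_preimage_eq_mul _ _ hD (measurableSet_badNoise _ _ _ _ _ _)]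
    refine mul_le_mul_right ?_ _
    refine measure_badNoise_le x b hd hT hlam
      (ξ := fun (s : Fin b.length) ω => η (L.length + s) ω) ?_ (fun s => hsub _ (by omega)) hθ _
    exact hind.precomp (g := fun s : Fin b.length => (⟨L.length + s, by omega⟩ : Fin T))
      fun s s' hs => by
        simp only [Fin.mk.injEq] at hs
        exact Fin.ext (by omega)
  calc μ {ω | IsBadBatch x T lam P θ (fun s => r s ω) ℓ}
      ≤ ∑' q, μ ({ω | state ω = q} ∩ bad q) :=
        (measure_mono hsubset).trans (measure_iUnion_le _)
    _ ≤ ∑' q, μ {ω | state ω = q} * ENNReal.ofReal (1 / T / batchBound T) :=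
        ENNReal.tsum_le_tsum hprod
    _ = μ (⋃ q, {ω | state ω = q}) * ENNReal.ofReal (1 / T / batchBound T) := by
        rw [ENNReal.tsum_mul_right, measure_iUnion _ hstate]
        intro q q' hqq
        refine Set.disjoint_left.2 fun ω h1 h2 => hqq ?_
        exact h1.symm.trans h2
    _ ≤ _ := mul_le_of_le_one_left zero_le prob_le_one

theorem IsBLAE.measure_exists_isBadBatch_le (h : IsBLAE x T lam P) (hd : 2 ≤ d)
    (hT : 3 ≤ T) (hlam : 0 < lam) (hθ : ‖θ‖ ≤ 1) (hind : iIndepFun (fun t : Fin T => η t) μ)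
    (hsub : ∀ t < T, HasSubgaussianMGF (η t) 1 μ) (hmeas : ∀ t, Measurable (r t))
    (hr : ∀ ω t i, (P.allPlayed T (fun s => r s ω))[t]? = some i →
      r t ω = inner ℝ (x i) θ + η t ω) :
    μ {ω | ∃ ℓ < batchBound T, IsBadBatch x T lam P θ (fun s => r s ω) ℓ} ≤
      ENNReal.ofReal (1 / T) := by
  have hb : (2 : ℝ) ≤ batchBound T := by exact_mod_cast two_le_batchBound hT
  have h1 : {ω | ∃ ℓ < batchBound T, IsBadBatch x T lam P θ (fun s => r s ω) ℓ} =
      ⋃ ℓ ∈ Finset.range (batchBound T), {ω | IsBadBatch x T lam P θ (fun s => r s ω) ℓ} := by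
    ext ω
    simp
  rw [h1]
  refine (measure_biUnion_finset_le _ _).trans ((Finset.sum_le_card_nsmul _ _ _ fun ℓ hℓ =>
    h.measure_isBadBatch_le hd hT hlam hθ hind hsub hmeas hr
      ((Finset.mem_range.1 hℓ).trans_le (batchBound_le hT))).trans ?_)
  rw [Finset.card_range, nsmul_eq_mul, ← ENNReal.ofReal_natCast,
    ← ENNReal.ofReal_mul (by positivity)]
  refine ENNReal.ofReal_le_ofReal (le_of_eq ?_)
  field_simp

end

/-! ### Elimination and regret on the good event -/

section

variable {d K : ℕ} {x : Fin K → EuclideanSpace ℝ (Fin d)} {T : ℕ} {lam : ℝ} {P : Policy K}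
  {θ : EuclideanSpace ℝ (Fin d)}

theorem inner_sub_estimator_le (hlam : 0 < lam) {r : ℕ → ℝ} {ℓ : ℕ}
    (hgood : ¬ IsBadBatch x T lam P θ r ℓ)
    {i j : Fin K} (hi : i ∈ P.arms T r ℓ) (hj : j ∈ P.arms T r ℓ) :
    inner ℝ (estimator x lam (P.pulls T r ℓ) (P.elapsed T r ℓ) r) (x i - x j) ≤
      inner ℝ θ (x i - x j) + confWidth x T lam (P.arms T r ℓ).toFinset (P.pulls T r ℓ) := by
  have h1 := estimator_ofLp_eq x (P.pulls T r ℓ) hlam θ (P.elapsed T r ℓ) r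
    (fun s => r (P.elapsed T r ℓ + s) - inner ℝ (x ((P.pulls T r ℓ).get s)) θ)
    fun s => by ring
  have hi' := List.mem_toFinset.2 hi
  have hj' := List.mem_toFinset.2 hj
  have h2 : ¬ _ < _ := fun h => hgood ⟨i, hi', j, hj', h⟩
  rw [not_lt] at h2
  rw [inner_eq_dotProduct, h1, add_dotProduct, ← inner_eq_dotProduct θ]
  refine add_le_add le_rfl ?_
  rw [dotProduct_comm]
  refine h2.trans (mul_le_mul_of_nonneg_right ?_
    (le_min (by unfold radiusLarge; positivity) (by unfold radiusSmall; positivity)))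
  exact le_ciSup (f := fun p : (P.arms T r ℓ).toFinset × (P.arms T r ℓ).toFinset =>
    wnorm (gram x lam (P.pulls T r ℓ))⁻¹ (x p.1 - x p.2)) (Set.finite_range _).bddAbove
    (⟨i, hi'⟩, ⟨j, hj'⟩)

/-- On the good event, a best arm is never eliminated. -/
theorem IsBLAE.best_mem_arms (h : IsBLAE x T lam P) (hlam : 0 < lam) {r : ℕ → ℝ}
    (hth : ∀ ℓ, P.elapsed T r (ℓ + 1) < T →
      confWidth x T lam (P.arms T r ℓ).toFinset (P.pulls T r ℓ) ≤ P.thresholdAt T r (ℓ + 1))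
    (hgood : ∀ ℓ, P.elapsed T r (ℓ + 1) < T → ¬ IsBadBatch x T lam P θ r ℓ)
    {k : Fin K} (hk : ∀ j, inner ℝ (x j) θ ≤ inner ℝ (x k) θ) {ℓ : ℕ}
    (hℓ : P.elapsed T r ℓ < T) : k ∈ P.arms T r ℓ := by
  induction ℓ with
  | zero => exact (h.init r).2 k
  | succ ℓ ih =>
    have hℓ' := elapsed_lt_of_succ hℓ
    obtain ⟨i₀, hi₀, -, -, -, hmem⟩ := h.update r ℓ hℓ'
    refine (hmem k).2 ⟨ih hℓ', ?_⟩
    have h1 := inner_sub_estimator_le hlam (hgood ℓ hℓ) hi₀ (ih hℓ')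
    have h2 : inner ℝ θ (x i₀ - x k) ≤ 0 := by
      rw [inner_sub_right, real_inner_comm, real_inner_comm _ θ]
      linarith [hk i₀]
    linarith [hth ℓ hℓ]

/-- A surviving arm is within the threshold of the empirical optimum, hence of the best arm, which
is still present; the estimated difference is off by at most the width. -/
theorem IsBLAE.gap_le (h : IsBLAE x T lam P) (hlam : 0 < lam) {r : ℕ → ℝ}
    (hth : ∀ ℓ, P.elapsed T r (ℓ + 1) < T →
      confWidth x T lam (P.arms T r ℓ).toFinset (P.pulls T r ℓ) ≤ P.thresholdAt T r (ℓ + 1))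
    (hgood : ∀ ℓ, P.elapsed T r (ℓ + 1) < T → ¬ IsBadBatch x T lam P θ r ℓ)
    {k : Fin K} (hk : ∀ j, inner ℝ (x j) θ ≤ inner ℝ (x k) θ) {ℓ : ℕ}
    (hℓ : P.elapsed T r (ℓ + 1) < T) {i : Fin K} (hi : i ∈ P.arms T r (ℓ + 1)) :
    inner ℝ (x k) θ - inner ℝ (x i) θ ≤ P.thresholdAt T r (ℓ + 1) +
      confWidth x T lam (P.arms T r ℓ).toFinset (P.pulls T r ℓ) := by
  have hℓ' := elapsed_lt_of_succ hℓ
  obtain ⟨i₀, hi₀, hmax, -, -, hmem⟩ := h.update r ℓ hℓ'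
  have hkm := h.best_mem_arms hlam hth hgood hk hℓ'
  obtain ⟨hi1, hi2⟩ := (hmem i).1 hi
  have h1 := inner_sub_estimator_le hlam (hgood ℓ hℓ) hi1 hkm
  have h2 := hmax k hkm
  rw [inner_sub_right] at hi2 h1
  rw [inner_sub_right] at h1
  linarith [real_inner_comm (x i) θ, real_inner_comm (x k) θ]

theorem regret_append (x : Fin K → EuclideanSpace ℝ (Fin d)) (θ : EuclideanSpace ℝ (Fin d))
    (b b' : List (Fin K)) : regret x θ (b ++ b') = regret x θ b + regret x θ b' := by
  simp [regret]

theorem regret_le_length_mul {b : List (Fin K)} {g : ℝ}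
    (hg : ∀ i ∈ b, (⨆ j, inner ℝ (x j) θ) - inner ℝ (x i) θ ≤ g) :
    regret x θ b ≤ b.length * g := by
  have := List.sum_le_card_nsmul (b.map fun i => (⨆ j, inner ℝ (x j) θ) - inner ℝ (x i) θ) g (by
    simpa using hg)
  simpa [regret] using this

theorem abs_inner_le_one (hx : ∀ i, ‖x i‖ ≤ 1) (hθ : ‖θ‖ ≤ 1) (i : Fin K) :
    |inner ℝ (x i) θ| ≤ 1 :=
  (abs_real_inner_le_norm _ _).trans (mul_le_one₀ (hx i) (norm_nonneg _) hθ)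

theorem gap_le_two (hx : ∀ i, ‖x i‖ ≤ 1) (hθ : ‖θ‖ ≤ 1) (i : Fin K) :
    (⨆ j, inner ℝ (x j) θ) - inner ℝ (x i) θ ≤ 2 := by
  have : Nonempty (Fin K) := ⟨i⟩
  have h1 : (⨆ j, inner ℝ (x j) θ) ≤ 1 := ciSup_le fun j => (abs_le.1 (abs_inner_le_one hx hθ j)).2
  linarith [(abs_le.1 (abs_inner_le_one hx hθ i)).1]

theorem gap_nonneg (i : Fin K) : 0 ≤ (⨆ j, inner ℝ (x j) θ) - inner ℝ (x i) θ :=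
  sub_nonneg.2 (le_ciSup (f := fun j => inner ℝ (x j) θ) (Set.finite_range _).bddAbove i)

theorem regret_nonneg (b : List (Fin K)) : 0 ≤ regret x θ b := by
  refine List.sum_nonneg fun g hg => ?_
  obtain ⟨i, _, rfl⟩ := List.mem_map.1 hg
  exact gap_nonneg i

/-- The target length is multiplied by the gap left by the previous batch, the at most K rounding
pulls by the trivial gap 2. The first batch has no predecessor, but N_1 = √T is small enough for the
gap 2. -/
theorem IsBLAE.regret_pulls_le (h : IsBLAE x T lam P) (hd : 2 ≤ d) (hK : 2 ≤ K) (hT : 3 ≤ T)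
    (hx : ∀ i, ‖x i‖ ≤ 1) (hθ : ‖θ‖ ≤ 1) (hlam : 0 < lam) {r : ℕ → ℝ} {C₁ M : ℝ} (hC₁ : 0 ≤ C₁)
    (hM : 0 ≤ M)
    (hth : ∀ ℓ, P.elapsed T r (ℓ + 1) < T →
      confWidth x T lam (P.arms T r ℓ).toFinset (P.pulls T r ℓ) ≤ P.thresholdAt T r (ℓ + 1))
    (hth' : ∀ ℓ, P.elapsed T r (ℓ + 1) < T → P.thresholdAt T r (ℓ + 1) ≤
      max (confWidth x T lam (P.arms T r ℓ).toFinset (P.pulls T r ℓ))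
        (M * thresholdOrder d K T (ℓ + 1)))
    (hwidth : ∀ ℓ, P.elapsed T r (ℓ + 1) < T →
      confWidth x T lam (P.arms T r ℓ).toFinset (P.pulls T r ℓ) ≤
        C₁ * thresholdOrder d K T (ℓ + 1))
    (hgood : ∀ ℓ, P.elapsed T r (ℓ + 1) < T → ¬ IsBadBatch x T lam P θ r ℓ) (ℓ : ℕ) :
    regret x θ (P.pulls T r ℓ) ≤
      (2 + (2 * C₁ + M)) * (√((d : ℝ) * T) * logFactor d K T) + 2 * K := by
  have hR : 0 ≤ √((d : ℝ) * T) * logFactor d K T :=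
    mul_nonneg (Real.sqrt_nonneg _) (zero_le_one.trans (one_le_logFactor hd hK hT))
  rcases (P.elapsed_le T r ℓ).eq_or_lt with h0 | h0
  · rw [P.pulls_eq_nil T r h0]
    simp only [regret, List.map_nil, List.sum_nil]
    positivity
  have hlen := h.length_pulls_le (by omega) (by omega) r ℓ
  have harms : ((P.arms T r ℓ).length : ℝ) ≤ K := by
    have := (h.arms_nodup h0).length_le_card
    rw [Fintype.card_fin] at this
    exact_mod_cast this
  have : Nonempty (Fin K) := ⟨⟨0, by omega⟩⟩
  obtain ⟨k, hk⟩ := Finite.exists_max fun j => inner ℝ (x j) θ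
  have hsup : (⨆ j, inner ℝ (x j) θ) = inner ℝ (x k) θ :=
    le_antisymm (ciSup_le hk) (le_ciSup (f := fun j => inner ℝ (x j) θ)
      (Set.finite_range _).bddAbove k)
  have hN := (targetLen_pos (T := T) (by omega) (ℓ + 1)).le
  have key : ∃ g : ℝ, 0 ≤ g ∧ (∀ i ∈ P.pulls T r ℓ,
      (⨆ j, inner ℝ (x j) θ) - inner ℝ (x i) θ ≤ g) ∧ targetLen T (ℓ + 1) * g ≤
      (2 + (2 * C₁ + M)) * (√((d : ℝ) * T) * logFactor d K T) := by
    cases ℓ with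
    | zero =>
      refine ⟨2, zero_le_two, fun i _ => gap_le_two hx hθ i, ?_⟩
      have := targetLen_one_le (T := T) hd hK hT
      have h1 : 0 ≤ (2 * C₁ + M) * (√((d : ℝ) * T) * logFactor d K T) := by positivity
      rw [zero_add]
      linarith
    | succ ℓ =>
      have hρ := thresholdOrder_nonneg (d := d) (K := K) (T := T) (ℓ + 1)
      refine ⟨(2 * C₁ + M) * thresholdOrder d K T (ℓ + 1), by positivity, fun i hi => ?_, ?_⟩
      · rw [hsup]
        refine (h.gap_le hlam hth hgood hk h0 (P.mem_arms_of_mem_pulls T r hi)).trans ?_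
        have h1 := hwidth ℓ h0
        have h2 : P.thresholdAt T r (ℓ + 1) ≤ (C₁ + M) * thresholdOrder d K T (ℓ + 1) :=
          (hth' ℓ h0).trans (max_le (h1.trans (by gcongr; linarith)) (by gcongr; linarith))
        linarith
      · rw [mul_left_comm, targetLen_mul_thresholdOrder hT]
        linarith
  obtain ⟨g, hg0, hg, hNg⟩ := key
  -- Bounding gaps by the minimum lets one product serve both parts of the batch: `g` is used for
  -- the target length and 2 for the rounding.
  have hmin : ∀ i ∈ P.pulls T r ℓ, (⨆ j, inner ℝ (x j) θ) - inner ℝ (x i) θ ≤ min g 2 :=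
    fun i hi => le_min (hg i hi) (gap_le_two hx hθ i)
  have hmin0 : 0 ≤ min g 2 := le_min hg0 zero_le_two
  calc regret x θ (P.pulls T r ℓ) ≤ (P.pulls T r ℓ).length * min g 2 := regret_le_length_mul hmin
    _ ≤ (targetLen T (ℓ + 1) + K) * min g 2 := by gcongr; linarith
    _ = targetLen T (ℓ + 1) * min g 2 + K * min g 2 := by ring
    _ ≤ targetLen T (ℓ + 1) * g + K * 2 := by
        gcongr
        · exact min_le_left _ _
        · exact min_le_right _ _
    _ ≤ _ := by linarith

theorem regret_played_le {r : ℕ → ℝ} {R : ℝ} (hR : ∀ ℓ, regret x θ (P.pulls T r ℓ) ≤ R) (n : ℕ) :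
    regret x θ (P.played T r n) ≤ n * R := by
  induction n with
  | zero => simp [Policy.played, regret]
  | succ n ih =>
    rw [Policy.played_succ, regret_append]
    push_cast
    linarith [hR n]

end

/-! ### From the good event to the expected regret -/

section

variable {d K : ℕ} {x : Fin K → EuclideanSpace ℝ (Fin d)} {T : ℕ} {lam : ℝ} {P : Policy K}
  {θ : EuclideanSpace ℝ (Fin d)} {Ω : Type*} [MeasurableSpace Ω] {μ : Measure Ω}
  [IsProbabilityMeasure μ] {η r : ℕ → Ω → ℝ}

theorem regret_le_two_mul (hx : ∀ i, ‖x i‖ ≤ 1) (hθ : ‖θ‖ ≤ 1) (r : ℕ → ℝ) :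
    regret x θ (P.allPlayed T r) ≤ 2 * T := by
  refine (regret_le_length_mul fun i _ => gap_le_two hx hθ i).trans ?_
  have h : ((P.allPlayed T r).length : ℝ) ≤ T := by exact_mod_cast P.elapsed_le T r T
  linarith

theorem IsBLAE.integrable_regret (h : IsBLAE x T lam P)
    (hx : ∀ i, ‖x i‖ ≤ 1)
    (hθ : ‖θ‖ ≤ 1) (hmeas : ∀ t, Measurable (r t)) :
    Integrable (fun ω => regret x θ (P.allPlayed T (fun s => r s ω))) μ := by
  have hplayed : ∀ L, MeasurableSet {ω | P.allPlayed T (fun s => r s ω) = L} := fun L => by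
    obtain ⟨D, hD, hDr⟩ := h.exists_measurableSet_played T L
    have h1 : {ω | P.allPlayed T (fun s => r s ω) = L} =
        (fun ω (s : Fin L.length) => r s ω) ⁻¹' D := by
      ext ω
      exact hDr fun s => r s ω
    rw [h1]
    exact (measurable_pi_lambda (fun ω (s : Fin L.length) => r s ω) fun s => hmeas s) hD
  have hm : Measurable fun ω => regret x θ (P.allPlayed T (fun s => r s ω)) := fun S _ =>
    measurableSet_of_discrete_fiber (p := fun _ L => regret x θ L ∈ S) hplayed
      fun _ => MeasurableSet.const _
  refine Integrable.of_bound hm.aestronglyMeasurable (2 * T) (ae_of_all _ fun ω => ?_)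
  rw [Real.norm_of_nonneg (regret_nonneg _)]
  exact regret_le_two_mul hx hθ _

/-- A bounded variable that is small outside a set of small probability has a small mean. -/
theorem integral_le_of_measure_le {f : Ω → ℝ} (hf : Integrable f μ) {B : Set Ω} {G S p : ℝ}
    (hG : 0 ≤ G) (hS : 0 ≤ S) (hp : 0 ≤ p) (hfS : ∀ ω, f ω ≤ S) (hfG : ∀ ω, ω ∉ B → f ω ≤ G)
    (hB : μ B ≤ ENNReal.ofReal p) : ∫ ω, f ω ∂μ ≤ G + S * p := by
  -- `B` need not be measurable; its measurable hull has the same measure.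
  have hm := measurableSet_toMeasurable μ B
  have hint : Integrable ((toMeasurable μ B).indicator fun _ => S) μ :=
    (integrable_const S).indicator hm
  calc ∫ ω, f ω ∂μ ≤ ∫ ω, (G + (toMeasurable μ B).indicator (fun _ => S) ω) ∂μ := by
        refine integral_mono hf ((integrable_const G).add hint) fun ω => ?_
        by_cases hω : ω ∈ toMeasurable μ B
        · simp only [Set.indicator_of_mem hω]
          linarith [hfS ω]
        · simp only [Set.indicator_of_notMem hω, add_zero]
          exact hfG ω fun h => hω (subset_toMeasurable μ B h)
    _ = G + S * μ.real (toMeasurable μ B) := by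
        rw [integral_add (integrable_const G) hint, integral_indicator_const _ hm]
        simp [mul_comm]
    _ ≤ G + S * p := by
        gcongr
        rw [measureReal_def, measure_toMeasurable]
        exact ENNReal.toReal_le_of_le_ofReal hp hB

end

end BLAE

/-! ### Choice of the constants and conclusion -/

theorem theorem1 (a cmin lamMax M : ℝ) (ha : 0 < a) (hcmin : 0 < cmin) (hlamMax : 0 < lamMax)
    (hM : 0 ≤ M) :
    ∃ C : ℝ, 0 < C ∧
      ∀ (d K T : ℕ), 2 ≤ d → 2 ≤ K → 3 ≤ T →
      a * max ((K : ℝ) ^ 2 / (min (d : ℝ) (Real.log K) * d)) ((K : ℝ) ^ (4 / 5 : ℝ)) ≤ (T : ℝ) →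
      ∀ (x : Fin K → EuclideanSpace ℝ (Fin d)), (∀ i, ‖x i‖ ≤ 1) →
      ∀ (lam : ℝ), 0 < lam → lam ≤ lamMax →
      ∀ (P : BLAE.Policy K), BLAE.IsBLAE x T lam P →
      (∀ ℓ t h, cmin ≤ P.rate ℓ t h) →
      (∀ (r : ℕ → ℝ) (ℓ : ℕ), P.elapsed T r (ℓ + 1) < T →
        BLAE.confWidth x T lam (P.arms T r ℓ).toFinset (P.pulls T r ℓ)
            ≤ P.thresholdAt T r (ℓ + 1) ∧
        P.thresholdAt T r (ℓ + 1) ≤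
          max (BLAE.confWidth x T lam (P.arms T r ℓ).toFinset (P.pulls T r ℓ))
            (M * BLAE.thresholdOrder d K T (ℓ + 1))) →
      -- the thresholds have the stated order
      (∀ (r : ℕ → ℝ) (ℓ : ℕ), P.elapsed T r (ℓ + 1) < T →
        BLAE.confWidth x T lam (P.arms T r ℓ).toFinset (P.pulls T r ℓ)
          ≤ C * BLAE.thresholdOrder d K T (ℓ + 1)) ∧
      -- the number of batches
      (∀ r : ℕ → ℝ, ∃ n : ℕ, n ≤ T ∧ (n : ℝ) ≤ C * Real.log (Real.log T) ∧
        P.elapsed T r n = T) ∧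
      -- the batch sizes
      (∀ (r : ℕ → ℝ) (ℓ : ℕ),
        ((P.pulls T r ℓ).length : ℝ)
          ≤ BLAE.targetLen T (ℓ + 1) + ((P.arms T r ℓ).length : ℝ) ∧
        (P.elapsed T r (ℓ + 1) < T →
          BLAE.targetLen T (ℓ + 1) ≤ ((P.pulls T r ℓ).length : ℝ))) ∧
      -- the expected regret
      (∀ {Ω : Type*} [MeasurableSpace Ω] (μ : Measure Ω) [IsProbabilityMeasure μ]
        (θ : EuclideanSpace ℝ (Fin d)), ‖θ‖ ≤ 1 →
        ∀ (η r : ℕ → Ω → ℝ),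
        iIndepFun (fun t : Fin T => η t) μ →
        (∀ t < T, HasSubgaussianMGF (η t) 1 μ) →
        (∀ t, Measurable (r t)) →
        (∀ ω t i, (P.allPlayed T (fun s => r s ω))[t]? = some i →
          r t ω = inner ℝ (x i) θ + η t ω) →
        Integrable (fun ω => BLAE.regret x θ (P.allPlayed T (fun s => r s ω))) μ ∧
        ∫ ω, BLAE.regret x θ (P.allPlayed T (fun s => r s ω)) ∂μ
          ≤ C * (√((d : ℝ) * T) * BLAE.logFactor d K T * Real.log (Real.log T)) ∧
        ∫ ω, BLAE.regret x θ (P.allPlayed T (fun s => r s ω)) ∂μ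
          ≤ C * (min (√((d : ℝ) * T * Real.log K)) ((d : ℝ) * √(T : ℝ)) * Real.log T)) := by
  obtain ⟨B, hB0, hB⟩ := BLAE.exists_batchBound_le
  have hκ := BLAE.log_log_three_pos
  set κ := Real.log (Real.log 3)
  set C₁ := 2 * √cmin⁻¹ * (14 + 2 * √lamMax) with hC₁
  have hC₁0 : 0 ≤ C₁ := by positivity
  -- The first summand is the number of batches times the regret of one, with K ≤ √a⁻¹ R; the second
  -- absorbs the contribution 2 of the bad event, since R log log T ≥ κ.
  set C₂ := B * (2 + (2 * C₁ + M) + 2 * √a⁻¹) + 2 / κ with hC₂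
  have hC₂0 : 0 < C₂ := by positivity
  -- One constant for all claims: `C₁` for the widths, `B` for the number of batches, `C₂` and `4 *
  -- C₂` for the two regret bounds.
  refine ⟨C₁ + B + 4 * C₂, by positivity, ?_⟩
  intro d K T hd hK hT hhor x hx lam hlam hle P hP hrate hth
  have hloglog : 0 < Real.log (Real.log T) := hκ.trans_le (BLAE.log_log_three_le hT)
  have hwidth : ∀ (r : ℕ → ℝ) (ℓ : ℕ), P.elapsed T r (ℓ + 1) < T →
      BLAE.confWidth x T lam (P.arms T r ℓ).toFinset (P.pulls T r ℓ)
        ≤ C₁ * BLAE.thresholdOrder d K T (ℓ + 1) := fun r ℓ hℓ =>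
    hP.confWidth_le hd hK hT hlam hle hcmin hrate hℓ
  refine ⟨fun r ℓ hℓ => (hwidth r ℓ hℓ).trans ?_, fun r => ?_, fun r ℓ =>
    ⟨hP.length_pulls_le (by omega) (by omega) r ℓ, hP.le_length_pulls (by omega)⟩, ?_⟩
  · exact mul_le_mul_of_nonneg_right (by linarith) (BLAE.thresholdOrder_nonneg _)
  · refine hP.exists_numBatches (by omega) hT ((hB T hT).trans ?_) r
    exact mul_le_mul_of_nonneg_right (by linarith) hloglog.le
  intro Ω _ μ _ θ hθ η r hind hsub hmeas hr
  have hint := hP.integrable_regret (μ := μ) hx hθ hmeas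
  have hL := BLAE.one_le_logFactor (T := T) hd hK hT
  have hd' : (2 : ℝ) ≤ d := by exact_mod_cast hd
  have hT' : (3 : ℝ) ≤ T := by exact_mod_cast hT
  have hS1 : 1 ≤ √((d : ℝ) * T) := Real.one_le_sqrt.2 (by nlinarith)
  set R := √((d : ℝ) * T) * BLAE.logFactor d K T with hR
  have hR1 : 1 ≤ R := one_le_mul_of_one_le_of_one_le hS1 hL
  have hKR : (K : ℝ) ≤ √a⁻¹ * R := by
    refine (BLAE.card_le_of_horizon ha hd hK
      ((mul_le_mul_of_nonneg_left (le_max_left _ _) ha.le).trans hhor)).trans ?_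
    have := BLAE.sqrt_min_le_logFactor (d := d) hK hT
    rw [hR]
    gcongr
  have hgood : ∀ ω, ω ∉ {ω | ∃ ℓ < BLAE.batchBound T,
      BLAE.IsBadBatch x T lam P θ (fun s => r s ω) ℓ} →
      BLAE.regret x θ (P.allPlayed T (fun s => r s ω)) ≤
        BLAE.batchBound T * ((2 + (2 * C₁ + M) + 2 * √a⁻¹) * R) := by
    intro ω hω
    have hω' : ∀ ℓ, P.elapsed T (fun s => r s ω) (ℓ + 1) < T →
        ¬ BLAE.IsBadBatch x T lam P θ (fun s => r s ω) ℓ := by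
      intro ℓ hℓ hbad
      -- A batch after which rounds remain is one of the first `batchBound T`, and the bad event
      -- covers those.
      refine hω ⟨ℓ, ?_, hbad⟩
      by_contra hlt
      have h1 := P.elapsed_mono T (fun s => r s ω) (by omega : BLAE.batchBound T ≤ ℓ + 1)
      rw [hP.elapsed_batchBound (by omega) hT] at h1
      omega
    rw [hP.allPlayed_eq (by omega) hT]
    refine BLAE.regret_played_le (fun ℓ => ?_) _
    refine (hP.regret_pulls_le hd hK hT hx hθ hlam hC₁0 hM (fun ℓ hℓ => (hth _ ℓ hℓ).1)
      (fun ℓ hℓ => (hth _ ℓ hℓ).2) (hwidth _) hω' ℓ).trans ?_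
    linarith
  have hmain : ∫ ω, BLAE.regret x θ (P.allPlayed T (fun s => r s ω)) ∂μ ≤
      C₂ * (R * Real.log (Real.log T)) := by
    have h1 := BLAE.integral_le_of_measure_le hint (by positivity) (by positivity : 0 ≤ 2 * (T : ℝ))
      (by positivity) (fun ω => BLAE.regret_le_two_mul hx hθ _) hgood
      (hP.measure_exists_isBadBatch_le hd hT hlam hθ hind hsub hmeas hr)
    refine h1.trans ?_
    have h2 : 2 * (T : ℝ) * (1 / T) = 2 := by field_simp
    have h3 : κ ≤ R * Real.log (Real.log T) :=
      (BLAE.log_log_three_le hT).trans (le_mul_of_one_le_left hloglog.le hR1)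
    have h4 : 2 ≤ 2 / κ * (R * Real.log (Real.log T)) := by
      rw [div_mul_eq_mul_div, le_div_iff₀ hκ]
      linarith
    have h5 : BLAE.batchBound T * ((2 + (2 * C₁ + M) + 2 * √a⁻¹) * R) ≤
        B * Real.log (Real.log T) * ((2 + (2 * C₁ + M) + 2 * √a⁻¹) * R) :=
      mul_le_mul_of_nonneg_right (hB T hT) (by positivity)
    rw [h2, hC₂]
    linarith
  have h0 : 0 ≤ R * Real.log (Real.log T) := by positivity
  refine ⟨hint, hmain.trans (mul_le_mul_of_nonneg_right (by linarith) h0), ?_⟩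
  have h1 := BLAE.first_rate_le_second_rate (T := T) hd hK hT
  calc _ ≤ C₂ * (R * Real.log (Real.log T)) := hmain
    _ ≤ C₂ * (4 * (min (√((d : ℝ) * T * Real.log K)) ((d : ℝ) * √(T : ℝ)) * Real.log T)) := by
        gcongr
    _ = 4 * C₂ * (min (√((d : ℝ) * T * Real.log K)) ((d : ℝ) * √(T : ℝ)) * Real.log T) := by ring
    _ ≤ _ := by
        refine mul_le_mul_of_nonneg_right (by linarith) (mul_nonneg ?_
          (Real.log_nonneg (by linarith)))
        positivity
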